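/- A group is called dihedral if it is a finite $2$-group that is generated by precisely two elements of order $2$ (that is, by two distinct involutions); in particular, the Klein four group is dihedral. Let $F$ be a field of characteristic $2$ and let $G$ and $H$ be finite $2$-groups. Assume that the center $\mathrm{Z}(G)$ is cyclic and that the central quotient $G/\mathrm{Z}(G)$ is dihedral. If the group algebras $FG$ and $FH$ are isomorphic as $F$-algebras, then the groups $G$ and $H$ are isomorphic. -/

import Mathlib

/-- A group is *dihedral* if it is a finite `2`-group generated by precisely two elements of
order `2`, that is, by two distinct involutions. In particular the Klein four group is dihedral,
while the trivial group and the group of order `2` are not. -/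
def IsDihedralTwoGroup (D : Type*) [Group D] : Prop :=
  Finite D ∧ IsPGroup 2 D ∧
    ∃ x y : D, orderOf x = 2 ∧ orderOf y = 2 ∧ x ≠ y ∧ Subgroup.closure {x, y} = ⊤

/-! G is generated by its cyclic center ⟨z⟩ together with a and b whose squares are central.
Multiplying a or b by a power of z changes the exponent of its square by an even number, so after a
choice of z one has a² = z^e, b² = z^f with (e, f) one of (0,0), (0,1), (1,1). The value of
(ab)^(2^(k+1)) is then forced, so G is determined by k, l, e, f, where |Z(G)| = 2^(l+1) and |G/Z(G)|
= 2^(k+2). The types coincide in two places: (0,1) becomes (0,0) when k = l = 0, and (1,1) becomes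
(0,1) when k = 0 and l > 0.

The group H lies in the same family. The group algebra determines the order of the group, the order
of the center and, by Frobenius powers modulo additive commutators, whether the center is cyclic; it
also determines |H : H'Z(H)|, which is therefore at most 4. So H/Z(H) has abelianization of order at
most 4, and by Taussky's theorem it has a cyclic subgroup of index at most two
(`exists_zpowers_index_le_two`). This gives an abelian subgroup of index two in H, and from it
generators modulo the center whose squares are central (`exists_generators_of_index_le_four`). Now k
and l are read off from the two orders.

It remains to separate the types for fixed k and l. If l > 0, the abelianization has exponent at
most 2^l in type (0,0) and larger in the types with f = 1, and its exponent is an invariant of the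
algebra. All other separations use elements x with x² = 0 and their values under point derivations,
which correspond to homomorphisms from the group to the additive group of F. `SquareZeroSeparates`
asks that square-zero elements detect every nonzero derivation, `SquareZeroDetects` that they detect
some. For l = 0, type (0,0) has the first property and the others do not; for k > 0, type (0,1) has
the second and (1,1) does not. The negative statements combine the trace identity for coefficients
of x² at central elements, a rigidity statement for square-zero elements over an abelian subgroup of
index two, and a computation in the dihedral quotient of order eight. -/

/-- The relations of a central extension of a dihedral group by a cyclic group. -/
structure DihedralExtRel (N M e f s : ℕ) {K : Type*} [Group K] (a b z : K) : Prop where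
  comm_a : Commute z a
  comm_b : Commute z b
  z_pow : z ^ M = 1
  a_sq : a ^ 2 = z ^ e
  b_sq : b ^ 2 = z ^ f
  ab_pow : (a * b) ^ N = z ^ s

/-! ### Normal forms and the universal property of the presentation -/

namespace DihedralExtRel

variable {N M e f s : ℕ} {K : Type*} [Group K] {a b z : K}

theorem comm_ab (h : DihedralExtRel N M e f s a b z) : Commute z (a * b) :=
  h.comm_a.mul_right h.comm_b

/-- Since a²b² = z^(e+f), conjugation by a inverts ab up to a central factor. This is the dihedral
relation behind all the normal forms. -/
theorem semiconj (h : DihedralExtRel N M e f s a b z) :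
    SemiconjBy a (a * b) (z ^ (e + f) * (a * b)⁻¹) := by
  unfold SemiconjBy
  rw [mul_inv_rev, pow_add, ← h.a_sq, ← h.b_sq]
  have hc : a ^ 2 * b ^ 2 = b ^ 2 * a ^ 2 := by
    rw [h.a_sq, h.b_sq, ← pow_add, ← pow_add, add_comm]
  calc a * (a * b) = (a ^ 2 * b ^ 2) * b⁻¹ := by simp only [pow_two]; group
    _ = a ^ 2 * b ^ 2 * (b⁻¹ * a⁻¹) * a := by group

theorem mul_zpow_ab (h : DihedralExtRel N M e f s a b z) (i : ℤ) :
    a * (a * b) ^ i = (a * b) ^ (-i) * z ^ (((e + f : ℕ) : ℤ) * i) * a := by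
  have h1 := (h.semiconj.zpow_right i).eq
  have h2 : Commute (z ^ (e + f)) (a * b)⁻¹ := (h.comm_ab.pow_left _).inv_right
  rw [h2.mul_zpow, inv_zpow', ← zpow_natCast, ← zpow_mul,
    ((h.comm_ab.zpow_left _).zpow_right _).eq] at h1
  exact h1

theorem exists_form (h : DihedralExtRel N M e f s a b z) {g : K}
    (hg : g ∈ Subgroup.closure {a, b, z}) :
    ∃ i j : ℤ, g = (a * b) ^ i * z ^ j ∨ g = (a * b) ^ i * z ^ j * a := by
  have hz : ∀ (k : ℤ) (y : K), (∃ i j : ℤ, y = (a * b) ^ i * z ^ j ∨ y = (a * b) ^ i * z ^ j * a) →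
      ∃ i j : ℤ, z ^ k * y = (a * b) ^ i * z ^ j ∨ z ^ k * y = (a * b) ^ i * z ^ j * a := by
    rintro k y ⟨i, j, hy⟩
    have hc := ((h.comm_ab.zpow_left k).zpow_right i).eq
    refine ⟨i, k + j, hy.imp ?_ ?_⟩ <;> rintro rfl
    · rw [← mul_assoc, hc, mul_assoc, ← zpow_add]
    · rw [← mul_assoc, ← mul_assoc, hc, mul_assoc ((a * b) ^ i), ← zpow_add]
  have hc : ∀ (y : K), (∃ i j : ℤ, y = (a * b) ^ i * z ^ j ∨ y = (a * b) ^ i * z ^ j * a) →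
      ∃ i j : ℤ, (a * b) * y = (a * b) ^ i * z ^ j ∨ (a * b) * y = (a * b) ^ i * z ^ j * a := by
    rintro y ⟨i, j, hy⟩
    refine ⟨1 + i, j, hy.imp ?_ ?_⟩ <;> rintro rfl <;> simp only [zpow_add, zpow_one, mul_assoc]
  have ha : ∀ (y : K), (∃ i j : ℤ, y = (a * b) ^ i * z ^ j ∨ y = (a * b) ^ i * z ^ j * a) →
      ∃ i j : ℤ, a * y = (a * b) ^ i * z ^ j ∨ a * y = (a * b) ^ i * z ^ j * a := by
    rintro y ⟨i, j, hy | hy⟩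
    · refine ⟨-i, ((e + f : ℕ) : ℤ) * i + j, Or.inr ?_⟩
      rw [hy, ← mul_assoc, h.mul_zpow_ab, mul_assoc _ a, (h.comm_a.zpow_left j).symm.eq,
        zpow_add]
      simp only [mul_assoc]
    · refine ⟨-i, ((e + f : ℕ) : ℤ) * i + j + e, Or.inl ?_⟩
      rw [hy, ← mul_assoc, ← mul_assoc, h.mul_zpow_ab, mul_assoc _ a,
        (h.comm_a.zpow_left j).symm.eq, zpow_add, zpow_add, zpow_natCast z e, ← h.a_sq, pow_two]
      simp only [mul_assoc]
  have hainv : a⁻¹ = z ^ (-(e : ℤ)) * a := by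
    rw [zpow_neg, zpow_natCast, ← h.a_sq]; group
  have hbinv : b⁻¹ = z ^ (-(f : ℤ)) * b := by
    rw [zpow_neg, zpow_natCast, ← h.b_sq]; group
  have hb' : ∀ (y : K), (∃ i j : ℤ, y = (a * b) ^ i * z ^ j ∨ y = (a * b) ^ i * z ^ j * a) →
      ∃ i j : ℤ, b * y = (a * b) ^ i * z ^ j ∨ b * y = (a * b) ^ i * z ^ j * a := by
    intro y hy
    have hby : b * y = z ^ (-(e : ℤ)) * (a * (a * b * y)) := by
      rw [← mul_assoc, ← hainv]; group
    rw [hby]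
    exact hz _ _ (ha _ (hc _ hy))
  induction hg using Subgroup.closure_induction_left with
  | one => exact ⟨0, 0, Or.inl (by simp)⟩
  | mul_left x hx y _ ih =>
    rcases hx with rfl | rfl | rfl
    · exact ha _ ih
    · exact hb' _ ih
    · simpa using hz 1 _ ih
  | inv_mul_cancel x hx y _ ih =>
    rcases hx with rfl | rfl | rfl
    · rw [hainv, mul_assoc]; exact hz _ _ (ha _ ih)
    · rw [hbinv, mul_assoc]; exact hz _ _ (hb' _ ih)
    · simpa using hz (-1) _ ih

theorem card_le (h : DihedralExtRel N M e f s a b z) (hN : 0 < N) (hM : 0 < M)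
    (hgen : Subgroup.closure {a, b, z} = ⊤) : Finite K ∧ Nat.card K ≤ 2 * N * M := by
  let F : Fin N × Fin M × Fin 2 → K := fun p ↦ (a * b) ^ p.1.val * z ^ p.2.1.val * a ^ p.2.2.val
  have hred : ∀ i j : ℤ, ∃ (p : Fin N) (q : Fin M),
      (a * b) ^ i * z ^ j = (a * b) ^ p.val * z ^ q.val := by
    intro i j
    have hN' : (0 : ℤ) < N := by exact_mod_cast hN
    have hM' : (0 : ℤ) < M := by exact_mod_cast hM
    set j' : ℤ := s * (i / N) + j with hj'
    refine ⟨⟨(i % N).toNat, ?_⟩, ⟨(j' % M).toNat, ?_⟩, ?_⟩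
    · have := Int.emod_lt_of_pos i hN'; have := Int.emod_nonneg i hN'.ne'; omega
    · have := Int.emod_lt_of_pos j' hM'; have := Int.emod_nonneg j' hM'.ne'; omega
    · have h1 : (a * b) ^ i = (a * b) ^ (i % N) * z ^ (s * (i / N)) := by
        conv_lhs => rw [← Int.emod_add_mul_ediv i N]
        rw [zpow_add, zpow_mul, zpow_natCast, h.ab_pow, zpow_mul, zpow_natCast]
      have h2 : z ^ j' = z ^ (j' % M) := by
        conv_lhs => rw [← Int.emod_add_mul_ediv j' M]
        rw [zpow_add, zpow_mul, zpow_natCast, h.z_pow, one_zpow, mul_one]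
      rw [h1, mul_assoc, ← zpow_add, ← hj', h2, ← zpow_natCast, ← zpow_natCast,
        Int.toNat_of_nonneg (Int.emod_nonneg _ hN'.ne'),
        Int.toNat_of_nonneg (Int.emod_nonneg _ hM'.ne')]
  have hF : Function.Surjective F := by
    intro g
    obtain ⟨i, j, hg⟩ := h.exists_form (g := g) (by rw [hgen]; trivial)
    obtain ⟨p, q, hpq⟩ := hred i j
    rcases hg with rfl | rfl
    · exact ⟨(p, q, 0), by simp [F, hpq]⟩
    · exact ⟨(p, q, 1), by simp [F, hpq]⟩
  refine ⟨Finite.of_surjective F hF, (Nat.card_le_card_of_surjective F hF).trans ?_⟩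
  simp only [Nat.card_prod, Nat.card_fin]
  exact le_of_eq (by ring)

/-- A group of the maximal possible order satisfies the universal property of the presentation. -/
theorem exists_hom {G : Type*} [Group G] [Finite G] {a' b' z' : G}
    (h' : DihedralExtRel N M e f s a' b' z') (hN : 0 < N) (hM : 0 < M)
    (hgen : Subgroup.closure {a', b', z'} = ⊤) (hcard : Nat.card G = 2 * N * M)
    (h : DihedralExtRel N M e f s a b z) : ∃ φ : G →* K, φ a' = a ∧ φ b' = b ∧ φ z' = z := by
  -- Goursat's argument: the paired generators satisfy the same relations, so Γ has at most 2NM =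
  -- |G| elements. As Γ projects onto G, it is the graph of the required homomorphism.
  let Γ : Subgroup (G × K) := Subgroup.closure {(a', a), (b', b), (z', z)}
  have ma : (a', a) ∈ Γ := Subgroup.subset_closure (by simp)
  have mb : (b', b) ∈ Γ := Subgroup.subset_closure (by simp)
  have mz : (z', z) ∈ Γ := Subgroup.subset_closure (by simp)
  let A : Γ := ⟨(a', a), ma⟩
  let B : Γ := ⟨(b', b), mb⟩
  let Z : Γ := ⟨(z', z), mz⟩
  have hrel : DihedralExtRel N M e f s A B Z :=
    ⟨Subtype.ext (Prod.ext h'.comm_a h.comm_a), Subtype.ext (Prod.ext h'.comm_b h.comm_b),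
      Subtype.ext (Prod.ext h'.z_pow h.z_pow), Subtype.ext (Prod.ext h'.a_sq h.a_sq),
      Subtype.ext (Prod.ext h'.b_sq h.b_sq), Subtype.ext (Prod.ext h'.ab_pow h.ab_pow)⟩
  have hΓ : Subgroup.closure {A, B, Z} = ⊤ := by
    have := Subgroup.closure_closure_coe_preimage (k := ({(a', a), (b', b), (z', z)} : Set (G × K)))
    rw [← this]
    congr 1
    ext ⟨x, hx⟩
    simp [A, B, Z]
  obtain ⟨hfin, hle⟩ := hrel.card_le hN hM hΓ
  let p : Γ →* G := (MonoidHom.fst G K).comp Γ.subtype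
  have hp : Function.Surjective p := by
    rw [← MonoidHom.range_eq_top, eq_top_iff, ← hgen, Subgroup.closure_le]
    rintro x (rfl | rfl | rfl)
    · exact ⟨A, rfl⟩
    · exact ⟨B, rfl⟩
    · exact ⟨Z, rfl⟩
  have hbij : Function.Bijective p :=
    (Nat.bijective_iff_surjective_and_card p).2
      ⟨hp, le_antisymm (hle.trans_eq hcard.symm) (Nat.card_le_card_of_surjective p hp)⟩
  let E : Γ ≃* G := MulEquiv.ofBijective p hbij
  have key : ∀ X : Γ, ((MonoidHom.snd G K).comp (Γ.subtype.comp E.symm.toMonoidHom)) (p X) =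
      X.1.2 := by
    intro X
    have : E.symm (p X) = X := E.symm_apply_apply X
    simp [this]
  exact ⟨_, key A, key B, key Z⟩

theorem nonempty_mulEquiv {G : Type*} [Group G] [Finite G] [Finite K] {a' b' z' : G}
    (h' : DihedralExtRel N M e f s a' b' z') (hN : 0 < N) (hM : 0 < M)
    (hgen' : Subgroup.closure {a', b', z'} = ⊤) (hcard' : Nat.card G = 2 * N * M)
    (h : DihedralExtRel N M e f s a b z) (hgen : Subgroup.closure {a, b, z} = ⊤)
    (hcard : Nat.card K = 2 * N * M) : Nonempty (G ≃* K) := by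
  obtain ⟨φ, ha, hb, hz⟩ := h'.exists_hom hN hM hgen' hcard' h
  have hφ : Function.Surjective φ := by
    rw [← MonoidHom.range_eq_top, eq_top_iff, ← hgen, Subgroup.closure_le]
    rintro x (rfl | rfl | rfl)
    · exact ⟨a', ha⟩
    · exact ⟨b', hb⟩
    · exact ⟨z', hz⟩
  exact ⟨MulEquiv.ofBijective φ
    ((Nat.bijective_iff_surjective_and_card φ).2 ⟨hφ, hcard'.trans hcard.symm⟩)⟩

end DihedralExtRel

/-- `G` is the extension of a dihedral group of order `2 ^ (k + 2)` by its cyclic center `⟨z⟩` of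
order `2 ^ (l + 1)`, with `a ^ 2 = z ^ e` and `b ^ 2 = z ^ f`. -/
structure IsDihedralExt (k l e f : ℕ) {G : Type*} [Group G] (a b z : G) : Prop
    extends DihedralExtRel (2 ^ (k + 1)) (2 ^ (l + 1)) e f ((e + f) * 2 ^ k + 2 ^ l) a b z where
  closure_eq_top : Subgroup.closure {a, b, z} = ⊤
  card_eq : Nat.card G = 2 * 2 ^ (k + 1) * 2 ^ (l + 1)
  center_eq : Subgroup.center G = Subgroup.zpowers z
  orderOf_eq : orderOf z = 2 ^ (l + 1)

/-! ### Standard presentations of groups with cyclic center -/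

section Structure

variable {G : Type*} [Group G]

theorem mul_zpow_sq_of_mem_center {x z : G} (hz : z ∈ Subgroup.center G) (q : ℤ) :
    (x * z ^ q) ^ 2 = x ^ 2 * z ^ (2 * q) := by
  have h : Commute x z := Subgroup.mem_center_iff.1 hz x
  have : Commute x (z ^ q) := h.zpow_right q
  rw [this.mul_pow, ← zpow_natCast, ← zpow_natCast, ← zpow_mul, mul_comm q]; rfl

theorem exists_sq_eq_one_or_eq_generator {x z : G} (hz : Subgroup.zpowers z = Subgroup.center G)
    (hx : x ^ 2 ∈ Subgroup.center G) :
    ∃ t ∈ Subgroup.center G, (x * t) ^ 2 = 1 ∨ (x * t) ^ 2 = z := by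
  have hzc : z ∈ Subgroup.center G := hz ▸ Subgroup.mem_zpowers z
  rw [← hz] at hx
  obtain ⟨j, hj⟩ := Subgroup.mem_zpowers_iff.1 hx
  rcases Int.even_or_odd' j with ⟨q, rfl | rfl⟩
  · refine ⟨z ^ (-q), Subgroup.zpow_mem _ hzc _, Or.inl ?_⟩
    rw [mul_zpow_sq_of_mem_center hzc, ← hj, ← zpow_add]; simp
  · refine ⟨z ^ (-q), Subgroup.zpow_mem _ hzc _, Or.inr ?_⟩
    rw [mul_zpow_sq_of_mem_center hzc, ← hj, ← zpow_add]
    ring_nf; simp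

theorem zpowers_zpow_of_odd {z : G} {m : ℕ} (hz : orderOf z = 2 ^ m) {j : ℤ} (hj : Odd j) :
    Subgroup.zpowers (z ^ j) = Subgroup.zpowers z := by
  apply le_antisymm
  · rw [Subgroup.zpowers_le]; exact ⟨j, rfl⟩
  · rw [Subgroup.zpowers_le]
    have hcop : IsCoprime j ((2 : ℤ) ^ m) := by
      apply IsCoprime.pow_right
      obtain ⟨q, rfl⟩ := hj
      exact ⟨1, -q, by ring⟩
    obtain ⟨u, v, huv⟩ := hcop
    refine ⟨u, ?_⟩
    change (z ^ j) ^ u = z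
    have h1 : z ^ ((2 : ℤ) ^ m) = 1 := by
      have := pow_orderOf_eq_one z
      rw [hz] at this
      exact_mod_cast this
    calc (z ^ j) ^ u = z ^ (u * j) * (z ^ ((2 : ℤ) ^ m)) ^ v := by
          rw [h1, one_zpow, mul_one, ← zpow_mul, mul_comm]
      _ = z ^ (u * j + v * 2 ^ m) := by rw [zpow_add, ← zpow_mul, mul_comm v]
      _ = z := by rw [huv, zpow_one]

theorem exists_sq_eq_one_or_zpowers_eq {x z : G} {m : ℕ} (ho : orderOf z = 2 ^ m)
    (hz : Subgroup.zpowers z = Subgroup.center G) (hx : x ^ 2 ∈ Subgroup.center G) :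
    (∃ t ∈ Subgroup.center G, (x * t) ^ 2 = 1) ∨ Subgroup.zpowers (x ^ 2) = Subgroup.center G := by
  have hzc : z ∈ Subgroup.center G := hz ▸ Subgroup.mem_zpowers z
  rw [← hz] at hx
  obtain ⟨j, hj⟩ := Subgroup.mem_zpowers_iff.1 hx
  rcases Int.even_or_odd' j with ⟨q, rfl | rfl⟩
  · refine Or.inl ⟨z ^ (-q), Subgroup.zpow_mem _ hzc _, ?_⟩
    rw [mul_zpow_sq_of_mem_center hzc, ← hj, ← zpow_add]; simp
  · right
    rw [← hj, ← hz]
    exact zpowers_zpow_of_odd ho ⟨q, rfl⟩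

theorem eq_pow_of_sq_eq_one {z y : G} {l : ℕ} (hz : orderOf z = 2 ^ (l + 1))
    (hy : y ∈ Subgroup.zpowers z) (hy2 : y ^ 2 = 1) (hy1 : y ≠ 1) : y = z ^ 2 ^ l := by
  obtain ⟨j, rfl⟩ := hy
  change z ^ j ≠ 1 at hy1
  change (z ^ j) ^ 2 = 1 at hy2
  change z ^ j = _
  rw [← zpow_natCast, ← zpow_mul, ← orderOf_dvd_iff_zpow_eq_one, hz] at hy2
  rw [ne_eq, ← orderOf_dvd_iff_zpow_eq_one, hz] at hy1
  push_cast at hy1 hy2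
  rw [pow_succ] at hy2
  obtain ⟨i, rfl⟩ := (mul_dvd_mul_iff_right (by norm_num : (2 : ℤ) ≠ 0)).1 hy2
  rcases Int.even_or_odd' i with ⟨q, rfl | rfl⟩
  · exact absurd ⟨q, by ring⟩ hy1
  · have h1 : z ^ ((2 : ℤ) ^ (l + 1)) = 1 := by
      have := pow_orderOf_eq_one z
      rw [hz] at this
      exact_mod_cast this
    rw [show (2 : ℤ) ^ l * (2 * q + 1) = 2 ^ (l + 1) * q + ((2 ^ l : ℕ) : ℤ) by push_cast; ring,
      zpow_add, zpow_mul, h1, one_zpow, one_mul, zpow_natCast]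

/-- A nonabelian `2`-group with cyclic center whose central quotient is generated by two elements
of order at most two has a standard presentation. -/
theorem exists_isDihedralExt_of_normalized [Finite G] (hG : IsPGroup 2 G)
    (hne : ¬ ∀ g h : G, g * h = h * g) {a b z : G} {e f : ℕ}
    (hz : Subgroup.zpowers z = Subgroup.center G) (ha : a ^ 2 = z ^ e) (hb : b ^ 2 = z ^ f)
    (hgen : Subgroup.closure {a, b, z} = ⊤) : ∃ k l, IsDihedralExt k l e f a b z := by
  have hzc : z ∈ Subgroup.center G := hz ▸ Subgroup.mem_zpowers z
  have hzcomm : ∀ g, Commute z g := fun g ↦ ((Subgroup.mem_center_iff.1 hzc) g).symm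
  have hcent : ∀ x : G, Commute x a → Commute x (a * b) → x ∈ Subgroup.center G := by
    intro x h1 h2
    have h3 : Commute x b := by
      have := h1.inv_right.mul_right h2
      simpa using this
    have : Subgroup.closure {a, b, z} ≤ Subgroup.centralizer {x} := by
      rw [Subgroup.closure_le]
      rintro y (rfl | rfl | rfl) <;> rw [SetLike.mem_coe, Subgroup.mem_centralizer_singleton_iff]
      · exact h1.symm
      · exact h3.symm
      · exact hzcomm x
    rw [hgen] at this
    rw [Subgroup.mem_center_iff]
    intro g
    exact Subgroup.mem_centralizer_singleton_iff.1 (this (Subgroup.mem_top g))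
  obtain ⟨m, hm⟩ := IsPGroup.iff_orderOf.1 hG z
  have hm0 : m ≠ 0 := by
    rintro rfl
    have : Nontrivial G := by
      by_contra h
      rw [not_nontrivial_iff_subsingleton] at h
      exact hne fun _ _ ↦ Subsingleton.elim _ _
    have := hG.center_nontrivial
    rw [pow_zero, orderOf_eq_one_iff] at hm
    subst hm
    rw [← hz, Subgroup.nontrivial_iff_ne_bot] at this
    exact this Subgroup.zpowers_one_eq_bot
  obtain ⟨l, rfl⟩ := Nat.exists_eq_succ_of_ne_zero hm0
  have hcard : Nat.card (Subgroup.center G) = 2 ^ (l + 1) := by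
    rw [← hz, Nat.card_zpowers, hm]
  have hnc : ¬ IsCyclic (G ⧸ Subgroup.center G) := fun h ↦
    hne ((QuotientGroup.mk' (Subgroup.center G)).isMulCommutative_of_isCyclic_of_ker_le_center
      (by simp)).is_comm.comm
  let cbar : G ⧸ Subgroup.center G := QuotientGroup.mk' _ (a * b)
  obtain ⟨r, hr⟩ := IsPGroup.iff_orderOf.1 (hG.to_quotient (Subgroup.center G)) cbar
  have hmem : ∀ n : ℕ, (a * b) ^ n ∈ Subgroup.center G ↔ 2 ^ r ∣ n := by
    intro n
    rw [← hr, orderOf_dvd_iff_pow_eq_one, ← map_pow, ← MonoidHom.mem_ker,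
      QuotientGroup.ker_mk']
  have hr0 : r ≠ 0 := by
    rintro rfl
    have h1 : a * b ∈ Subgroup.center G := by simpa using (hmem 1).2 (by simp)
    have h2 : a ∈ Subgroup.center G :=
      hcent a (Commute.refl a) (Subgroup.mem_center_iff.1 h1 a)
    have h3 : b ∈ Subgroup.center G := by
      simpa using mul_mem (inv_mem h2) h1
    have : Subgroup.closure {a, b, z} ≤ Subgroup.center G := by
      rw [Subgroup.closure_le]
      rintro y (rfl | rfl | rfl) <;> assumption
    rw [hgen] at this
    exact hne fun g h ↦ Subgroup.mem_center_iff.1 (this (Subgroup.mem_top h)) g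
  obtain ⟨k, rfl⟩ := Nat.exists_eq_succ_of_ne_zero hr0
  -- With N = 0 and s = 0 the last relation is vacuous, which makes the dihedral conjugation formula
  -- available before the power of ab is known.
  have h0 : DihedralExtRel 0 (2 ^ (l + 1)) e f 0 a b z :=
    ⟨hzcomm a, hzcomm b, hm ▸ pow_orderOf_eq_one z, ha, hb, by simp⟩
  set t := (a * b) ^ 2 ^ k with ht
  set v := z ^ ((e + f) * 2 ^ k) with hv
  have hat : a * t = t⁻¹ * v * a := by
    have := h0.mul_zpow_ab ((2 ^ k : ℕ) : ℤ)
    rw [zpow_neg, zpow_natCast, ← Nat.cast_mul, zpow_natCast] at this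
    exact this
  have hvt : Commute v t := (h0.comm_ab.pow_left _).pow_right _
  have ht2 : t ^ 2 ∈ Subgroup.center G := by
    rw [ht, ← pow_mul, ← pow_succ]; exact (hmem _).2 dvd_rfl
  have htn : t ∉ Subgroup.center G := by
    rw [ht, hmem]
    intro h
    have := Nat.le_of_dvd (by positivity) h
    exact absurd this (not_le.2 (Nat.pow_lt_pow_right (by norm_num) (Nat.lt_succ_self k)))
  have hvc : v ∈ Subgroup.center G := pow_mem hzc _
  -- Conjugation by a sends t to t⁻¹v and fixes the central element t², so t⁴ = v². Moreover t² ≠ v,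
  -- since otherwise t would commute with a and ab and be central. Hence t²v⁻¹ is the unique
  -- involution z^(2^l) of the center.
  have hy2 : (t ^ 2 * v⁻¹) ^ 2 = 1 := by
    have hs : SemiconjBy a t (t⁻¹ * v) := hat
    have h1 := (hs.pow_right 2).eq
    have h2 : a * t ^ 2 = t ^ 2 * a := Subgroup.mem_center_iff.1 ht2 a
    rw [h2, hvt.symm.inv_left.mul_pow] at h1
    have h3 := mul_right_cancel h1
    have h4 : Commute (t ^ 2) v⁻¹ := (hvt.symm.pow_left 2).inv_right
    rw [h4.mul_pow, pow_two (t ^ 2)]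
    nth_rewrite 2 [h3]
    simp
  have hy1 : t ^ 2 * v⁻¹ ≠ 1 := by
    intro h
    have h1 : t ^ 2 = v := mul_inv_eq_one.1 h
    apply htn
    refine hcent t ?_ ((Commute.refl _).pow_left _)
    change t * a = a * t
    rw [hat, ← h1, pow_two, inv_mul_cancel_left]
  have hyz : t ^ 2 * v⁻¹ ∈ Subgroup.zpowers z := by
    rw [hz]; exact mul_mem ht2 (inv_mem hvc)
  have hyl := eq_pow_of_sq_eq_one hm hyz hy2 hy1
  have hrel : DihedralExtRel (2 ^ (k + 1)) (2 ^ (l + 1)) e f ((e + f) * 2 ^ k + 2 ^ l) a b z := by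
    refine ⟨h0.comm_a, h0.comm_b, h0.z_pow, ha, hb, ?_⟩
    rw [pow_succ, pow_mul, ← ht, pow_add, ← hv, ← hyl]
    have h4 : Commute (t ^ 2) v⁻¹ := (hvt.symm.pow_left 2).inv_right
    rw [h4.eq, mul_inv_cancel_left]
  refine ⟨k, l, hrel, hgen, le_antisymm (hrel.card_le (by positivity) (by positivity) hgen).2 ?_,
    hz.symm, hm⟩
  rw [Subgroup.card_eq_card_quotient_mul_card_subgroup (Subgroup.center G), hcard]
  apply Nat.mul_le_mul_right
  rw [← Subgroup.card_mul_index (Subgroup.zpowers cbar), Nat.card_zpowers, hr, mul_comm]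
  apply Nat.mul_le_mul_left
  -- G is not abelian, so its central quotient is not cyclic; the image of ab, of order 2^(k+1),
  -- thus generates a subgroup of index at least two. This is the lower bound for |G|.
  have h1 : (Subgroup.zpowers cbar).index ≠ 1 := by
    rw [ne_eq, Subgroup.index_eq_one]
    intro h
    exact hnc ⟨cbar, fun x ↦ Subgroup.mem_zpowers_iff.1 (h ▸ Subgroup.mem_top x)⟩
  have h2 : (Subgroup.zpowers cbar).index ≠ 0 := Subgroup.index_ne_zero_of_finite
  omega

/-- If x² is an even power of z, a central factor makes it 1; if it is an odd power, x² itself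
generates the center and can replace z. When only one generator has a nontrivial square, it is named
b, which accounts for the swap of a and b below. -/
theorem exists_isDihedralExt [Finite G] (hG : IsPGroup 2 G)
    (hne : ¬ ∀ g h : G, g * h = h * g) (hcyc : IsCyclic (Subgroup.center G)) {a b : G}
    (ha : a ^ 2 ∈ Subgroup.center G) (hb : b ^ 2 ∈ Subgroup.center G)
    (hgen : Subgroup.closure {a, b} ⊔ Subgroup.center G = ⊤) :
    ∃ (k l e f : ℕ) (a b z : G), IsDihedralExt k l e f a b z ∧
      (e = 0 ∧ f = 0 ∨ e = 0 ∧ f = 1 ∨ e = 1 ∧ f = 1) := by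
  obtain ⟨z, hz⟩ : ∃ z, Subgroup.zpowers z = Subgroup.center G :=
    Subgroup.isCyclic_iff_exists_zpowers_eq_top _ |>.1 hcyc
  have key : ∀ {s t z' : G}, s ∈ Subgroup.center G → t ∈ Subgroup.center G →
      Subgroup.zpowers z' = Subgroup.center G →
      Subgroup.closure {a * s, b * t, z'} = ⊤ := by
    intro s t z' hs ht hz'
    have hc : Subgroup.center G ≤ Subgroup.closure {a * s, b * t, z'} := by
      rw [← hz', Subgroup.zpowers_le]; exact Subgroup.subset_closure (by simp)
    rw [eq_top_iff, ← hgen, sup_le_iff, Subgroup.closure_le]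
    refine ⟨?_, hc⟩
    rintro x (rfl | rfl)
    · have h1 : x * s ∈ Subgroup.closure {x * s, b * t, z'} := Subgroup.subset_closure (by simp)
      simpa using mul_mem h1 (inv_mem (hc hs))
    · have h1 : x * t ∈ Subgroup.closure {a * s, x * t, z'} := Subgroup.subset_closure (by simp)
      simpa using mul_mem h1 (inv_mem (hc ht))
  have hsq : ∀ {x t : G}, t ∈ Subgroup.center G → x ^ 2 ∈ Subgroup.center G →
      (x * t) ^ 2 ∈ Subgroup.center G := by
    intro x t ht hx
    have := mul_zpow_sq_of_mem_center (x := x) ht 1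
    rw [zpow_one] at this
    rw [this]
    exact mul_mem hx (zpow_mem ht _)
  obtain ⟨m, hm⟩ := IsPGroup.iff_orderOf.1 hG z
  rcases exists_sq_eq_one_or_zpowers_eq hm hz ha with ⟨s, hs, hs1⟩ | hza
  · rcases exists_sq_eq_one_or_zpowers_eq hm hz hb with ⟨t, ht, ht1⟩ | hzb
    · obtain ⟨k, l, h⟩ := exists_isDihedralExt_of_normalized (e := 0) (f := 0) hG hne hz
        (by simpa using hs1) (by simpa using ht1) (key hs ht hz)
      exact ⟨k, l, 0, 0, _, _, _, h, by simp⟩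
    · obtain ⟨k, l, h⟩ := exists_isDihedralExt_of_normalized (e := 0) (f := 1) hG hne hzb
        (by simpa using hs1) (by simp) (key hs (one_mem _) hzb)
      exact ⟨k, l, 0, 1, _, _, _, h, by simp⟩
  · obtain ⟨t, ht, ht1 | ht1⟩ := exists_sq_eq_one_or_eq_generator hza hb
    · obtain ⟨k, l, h⟩ := exists_isDihedralExt_of_normalized (e := 0) (f := 1)
        (a := b * t) (b := a * 1) hG hne hza
        (by simpa using ht1) (by simp) (by rw [Set.insert_comm]; exact key (one_mem _) ht hza)
      exact ⟨k, l, 0, 1, _, _, _, h, by simp⟩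
    · obtain ⟨k, l, h⟩ := exists_isDihedralExt_of_normalized (e := 1) (f := 1)
        (a := a * 1) (b := b * t) hG hne hza
        (by simp) (by simpa using ht1) (key (one_mem _) ht hza)
      exact ⟨k, l, 1, 1, _, _, _, h, by simp⟩

end Structure

/-! ### Coincidences between the types, and squares of elements -/

namespace IsDihedralExt

variable {G : Type*} [Group G] {k l e f : ℕ} {a b z : G}

/-- Here (ab)² = z² = 1, so the group of order eight is also generated by the involutions a and ab.
-/
theorem change_generators_order_eight (h : IsDihedralExt 0 0 0 1 a b z) :
    IsDihedralExt 0 0 0 0 a (a * b) z := by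
  have ha : a ^ 2 = 1 := by simpa using h.a_sq
  have hz : z ^ 2 = 1 := by simpa using h.z_pow
  have hab : (a * b) ^ 2 = 1 := by simpa [hz] using h.ab_pow
  have haab : a * (a * b) = b := by rw [← mul_assoc, ← pow_two, ha, one_mul]
  refine ⟨⟨h.comm_a, h.comm_ab, h.z_pow, by simpa using ha, by simpa using hab, ?_⟩,
    ?_, h.card_eq, h.center_eq, h.orderOf_eq⟩
  · rw [haab]; simpa using h.b_sq
  · rw [eq_top_iff, ← h.closure_eq_top, Subgroup.closure_le]
    have ma : a ∈ Subgroup.closure {a, a * b, z} := Subgroup.subset_closure (by simp)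
    have mab : a * b ∈ Subgroup.closure {a, a * b, z} := Subgroup.subset_closure (by simp)
    rintro x (rfl | rfl | rfl)
    · exact ma
    · simpa using mul_mem (inv_mem ma) mab
    · exact Subgroup.subset_closure (by simp)

/-- The square of ab is z^(2 + 2^(l+1)), an even power of z. The correcting exponent -1 + 2^l is
chosen so that the new square is z^(2^(l+2)) = 1. -/
theorem change_generators_of_class_two (h : IsDihedralExt 0 (l + 1) 1 1 a b z) :
    IsDihedralExt 0 (l + 1) 0 1 (a * b * z ^ ((-1 : ℤ) + 2 ^ l)) b z := by
  have hzc : z ∈ Subgroup.center G := h.center_eq ▸ Subgroup.mem_zpowers z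
  have ha : a ^ 2 = z := by simpa using h.a_sq
  have hb : b ^ 2 = z := by simpa using h.b_sq
  have hz : z ^ ((2 : ℤ) ^ (l + 2)) = 1 := by exact_mod_cast h.z_pow
  have hab : (a * b) ^ 2 = z ^ ((2 : ℤ) + 2 ^ (l + 1)) := by
    have := h.ab_pow
    simp only [zero_add, pow_one, pow_zero, mul_one] at this
    rw [this, ← zpow_natCast]; norm_num
  have hcz : ∀ q : ℤ, Commute (z ^ q) b := fun q ↦ h.comm_b.zpow_left q
  refine ⟨⟨h.comm_ab.mul_right ((Commute.refl z).zpow_right _), h.comm_b, h.z_pow, ?_, by simpa,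
    ?_⟩, ?_, h.card_eq, h.center_eq, h.orderOf_eq⟩
  · rw [mul_zpow_sq_of_mem_center hzc, hab, ← zpow_add, pow_zero, ← hz]
    congr 1; ring
  · have : a * b * z ^ ((-1 : ℤ) + 2 ^ l) * b = a * z ^ ((2 : ℤ) ^ l) := by
      rw [mul_assoc, (hcz _).eq, ← mul_assoc, mul_assoc a, ← pow_two, hb, mul_assoc]
      nth_rewrite 1 [← zpow_one z]
      rw [← zpow_add]; congr 2; ring
    rw [this]
    simp only [zero_add, pow_one, pow_zero, mul_one]
    rw [mul_zpow_sq_of_mem_center hzc, ha, pow_add, pow_one, ← zpow_natCast]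
    congr 2; push_cast; ring
  · rw [eq_top_iff, ← h.closure_eq_top, Subgroup.closure_le]
    have mb : b ∈ Subgroup.closure {a * b * z ^ ((-1 : ℤ) + 2 ^ l), b, z} :=
      Subgroup.subset_closure (by simp)
    have mz : z ∈ Subgroup.closure {a * b * z ^ ((-1 : ℤ) + 2 ^ l), b, z} :=
      Subgroup.subset_closure (by simp)
    have mab : a * b * z ^ ((-1 : ℤ) + 2 ^ l) ∈
      Subgroup.closure {a * b * z ^ ((-1 : ℤ) + 2 ^ l), b, z} :=
      Subgroup.subset_closure (by simp)
    rintro x (rfl | rfl | rfl)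
    · simpa using mul_mem (mul_mem mab (inv_mem (zpow_mem mz ((-1 : ℤ) + 2 ^ l)))) (inv_mem mb)
    · exact mb
    · exact mz

/-- Sending z to 1 trivializes every central exponent, so only the relations of the dihedral
quotient have to be checked. -/
theorem exists_lift [Finite G] (h : IsDihedralExt k l e f a b z) {K : Type*} [Group K] {a' b' : K}
    (ha : a' ^ 2 = 1) (hb : b' ^ 2 = 1) (hab : (a' * b') ^ 2 ^ (k + 1) = 1) :
    ∃ φ : G →* K, φ a = a' ∧ φ b = b' ∧ φ z = 1 :=
  h.toDihedralExtRel.exists_hom (by positivity) (by positivity) h.closure_eq_top h.card_eq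
    ⟨Commute.one_left _, Commute.one_left _, one_pow _, by simpa using ha, by simpa using hb,
      by simpa using hab⟩

theorem exists_zpow_form (h : IsDihedralExt k l e f a b z) (g : G) :
    ∃ i j : ℤ, g = (a * b) ^ i * z ^ j ∨ g = (a * b) ^ i * z ^ j * a :=
  h.exists_form (by rw [h.closure_eq_top]; trivial)

theorem sq_eq (h : IsDihedralExt k l e f a b z) (i j : ℤ) :
    ((a * b) ^ i * z ^ j * a) ^ 2 = z ^ (2 * j + ((e + f : ℕ) : ℤ) * i + e) := by
  have h1 : Commute (z ^ j) a := h.comm_a.zpow_left j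
  have h2 : Commute (z ^ j) ((a * b) ^ (-i)) := (h.comm_ab.zpow_left j).zpow_right _
  calc ((a * b) ^ i * z ^ j * a) ^ 2
      = (a * b) ^ i * z ^ j * (a * (a * b) ^ i) * (z ^ j * a) := by
        rw [pow_two]; simp only [mul_assoc]
    _ = (a * b) ^ i * (z ^ j * (a * b) ^ (-i)) * z ^ (((e + f : ℕ) : ℤ) * i) * (a * z ^ j) * a := by
        rw [h.mul_zpow_ab]; simp only [mul_assoc]
    _ = z ^ j * z ^ (((e + f : ℕ) : ℤ) * i) * z ^ j * a ^ 2 := by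
        rw [h2.eq, ← h1.eq, pow_two, zpow_neg]; simp only [mul_assoc, mul_inv_cancel_left]
    _ = _ := by
        rw [h.a_sq, ← zpow_natCast, ← zpow_add, ← zpow_add, ← zpow_add]; congr 1; ring

theorem mem_center_of_commute (h : IsDihedralExt k l e f a b z) {x : G} (ha : Commute x a)
    (hb : Commute x b) : x ∈ Subgroup.center G := by
  have hzc : z ∈ Subgroup.center G := h.center_eq ▸ Subgroup.mem_zpowers z
  have : Subgroup.closure {a, b, z} ≤ Subgroup.centralizer {x} := by
    rw [Subgroup.closure_le]
    rintro y (rfl | rfl | rfl) <;> rw [SetLike.mem_coe, Subgroup.mem_centralizer_singleton_iff]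
    · exact ha.symm
    · exact hb.symm
    · exact (Subgroup.mem_center_iff.1 hzc x).symm
  rw [h.closure_eq_top] at this
  rw [Subgroup.mem_center_iff]
  intro g
  exact Subgroup.mem_centralizer_singleton_iff.1 (this (Subgroup.mem_top g))

theorem zpow_odd_ne_zpow_even (h : IsDihedralExt k l e f a b z) (i j : ℤ) :
    z ^ (2 * i + 1) ≠ z ^ (2 * j) := by
  intro heq
  have h1 : z ^ (2 * i + 1 - 2 * j) = 1 := by rw [zpow_sub, heq, mul_inv_cancel]
  rw [← orderOf_dvd_iff_zpow_eq_one, h.orderOf_eq, pow_succ] at h1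
  obtain ⟨q, hq⟩ := h1
  have h2 : (2 : ℤ) ∣ 2 * i + 1 - 2 * j := ⟨2 ^ l * q, by rw [hq]; push_cast; ring⟩
  omega

end IsDihedralExt

/-! ### Commutators in a group with an abelian subgroup of index two -/

section Commutator

variable {P : Type*} [Group P]

/-- Conjugation by `a` on a normal abelian subgroup `B`, as the homomorphism `x ↦ ⁅x, a⁆`. -/
def commutatorHom (B : Subgroup P) [B.Normal] (hB : ∀ x ∈ B, ∀ y ∈ B, x * y = y * x) (a : P) :
    B →* P where
  toFun x := x * (a * x * a⁻¹)⁻¹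
  map_one' := by simp
  map_mul' x y := by
    have h1 : (a * x * a⁻¹)⁻¹ ∈ B := inv_mem (Subgroup.Normal.conj_mem inferInstance _ x.2 a)
    have h2 : (a * y * a⁻¹)⁻¹ ∈ B := inv_mem (Subgroup.Normal.conj_mem inferInstance _ y.2 a)
    have h3 : (a * (x * y) * a⁻¹)⁻¹ = (a * x * a⁻¹)⁻¹ * (a * y * a⁻¹)⁻¹ := by
      rw [hB _ h1 _ h2]; group
    rw [Subgroup.coe_mul, h3, mul_assoc (x : P) y, ← mul_assoc (y : P), hB _ y.2 _ h1]
    simp only [mul_assoc]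

variable {B : Subgroup P} [B.Normal] (hB : ∀ x ∈ B, ∀ y ∈ B, x * y = y * x) {a : P}

/-- Every element is x or xa with x in B, and as B is abelian each commutator reduces to a product
of elements ⁅x, a⁆ and their inverses. These already form a subgroup, being the image of a
homomorphism on B. -/
theorem commutator_le_range_commutatorHom (hi : B.index = 2) (ha : a ∉ B) :
    commutator P ≤ (commutatorHom B hB a).range := by
  have hc : ∀ {x}, x ∈ B → ∀ (g : P), g * x * g⁻¹ ∈ B := fun hx g ↦
    Subgroup.Normal.conj_mem inferInstance _ hx g
  have hform : ∀ g, ∃ x ∈ B, g = x ∨ g = x * a := by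
    intro g
    by_cases hg : g ∈ B
    · exact ⟨g, hg, Or.inl rfl⟩
    · refine ⟨g * a⁻¹, ?_, Or.inr (by simp)⟩
      rw [Subgroup.mul_mem_iff_of_index_two hi]
      simp [hg, ha]
  rw [commutator_def, Subgroup.commutator_le]
  intro g _ h _
  obtain ⟨x, hx, hg⟩ := hform g
  obtain ⟨y, hy, hh⟩ := hform h
  rw [commutatorElement_def]
  have hcx := inv_mem (hc hx a)
  have hcy := inv_mem (hc hy a)
  rcases hg with rfl | rfl <;> rcases hh with rfl | rfl
  · rw [hB _ hx _ hy]; simp [one_mem]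
  · refine ⟨⟨g, hx⟩, ?_⟩
    change g * (a * g * a⁻¹)⁻¹ = _
    calc g * (a * g * a⁻¹)⁻¹ = g * (y * (a * g * a⁻¹)⁻¹) * y⁻¹ := by
          rw [hB _ hy _ hcx]; group
      _ = _ := by group
  · refine inv_mem_iff.1 ⟨⟨h, hy⟩, ?_⟩
    change h * (a * h * a⁻¹)⁻¹ = _
    calc h * (a * h * a⁻¹)⁻¹ = h * (x * (a * h * a⁻¹)⁻¹) * x⁻¹ := by
          rw [hB _ hx _ hcy]; group
      _ = _ := by group
  · have : x * a * (y * a) * (x * a)⁻¹ * (y * a)⁻¹ =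
        commutatorHom B hB a ⟨x, hx⟩ * (commutatorHom B hB a ⟨y, hy⟩)⁻¹ := by
      change _ = x * (a * x * a⁻¹)⁻¹ * (y * (a * y * a⁻¹)⁻¹)⁻¹
      calc _ = x * ((a * y * a⁻¹)  * (a * x * a⁻¹)⁻¹) * y⁻¹ := by group
        _ = x * ((a * x * a⁻¹)⁻¹ * (a * y * a⁻¹)) * y⁻¹ := by
            rw [hB _ (hc hy a) _ hcx]
        _ = _ := by group
    rw [this]
    exact mul_mem ⟨_, rfl⟩ (inv_mem ⟨_, rfl⟩)

theorem mem_ker_commutatorHom {x : B} : x ∈ (commutatorHom B hB a).ker ↔ a * x = x * a := by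
  rw [MonoidHom.mem_ker]
  change (x : P) * (a * x * a⁻¹)⁻¹ = 1 ↔ _
  rw [mul_inv_eq_one, eq_mul_inv_iff_mul_eq, eq_comm]

end Commutator

/-! ### Taussky's theorem: 2-groups with small abelianization -/

section Taussky

theorem IsPGroup.exists_mem_center_of_normal {p : ℕ} [Fact p.Prime] {P : Type*} [Group P] [Finite P]
    (hP : IsPGroup p P) (N : Subgroup P) [N.Normal] (hN : N ≠ ⊥) :
    ∃ x ∈ N, x ≠ 1 ∧ x ∈ Subgroup.center P := by
  have hP' : IsPGroup p (ConjAct P) := hP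
  have hdvd : p ∣ Nat.card N := by
    obtain ⟨n, hn⟩ := IsPGroup.iff_card.1 (hP.to_subgroup N)
    rw [hn]
    refine dvd_pow_self p ?_
    rintro rfl
    exact hN (Subgroup.card_eq_one.1 hn)
  have h1 : (1 : N) ∈ MulAction.fixedPoints (ConjAct P) N := by
    intro g; apply Subtype.ext; simp
  obtain ⟨y, hy, hy1⟩ := hP'.exists_fixed_point_of_prime_dvd_card_of_fixed_point N hdvd h1
  refine ⟨y, y.2, fun h ↦ hy1 (Subtype.ext h.symm), Subgroup.mem_center_iff.2 fun g ↦ ?_⟩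
  have := congrArg Subtype.val (hy (ConjAct.toConjAct g))
  rw [ConjAct.Subgroup.val_conj_smul, ConjAct.smul_def] at this
  exact mul_inv_eq_iff_eq_mul.1 this

/-- As a² acts trivially on the abelian group B, conjugation by a is an involution there, and it
fixes the norm of x. -/
theorem commute_conj_mul_self {P : Type*} [Group P] {B : Subgroup P} [B.Normal]
    (hB : ∀ x ∈ B, ∀ y ∈ B, x * y = y * x) {a x : P} (ha2 : a ^ 2 ∈ B) (hx : x ∈ B) :
    a * (x * (a * x * a⁻¹)) = x * (a * x * a⁻¹) * a := by
  have hc : a * x * a⁻¹ ∈ B := Subgroup.Normal.conj_mem inferInstance _ hx a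
  calc a * (x * (a * x * a⁻¹)) = (a * x * a⁻¹) * (a ^ 2 * x) * a⁻¹ := by
        rw [pow_two]; group
    _ = ((a * x * a⁻¹) * x) * a := by rw [hB _ ha2 _ hx, pow_two]; group
    _ = x * (a * x * a⁻¹) * a := by rw [hB _ hc _ hx]

theorem index_zpowers_le_two_of_card_le {P : Type*} [Group P] [Finite P] {y : P} {n : ℕ}
    (hy : n ≤ orderOf y) (hP : Nat.card P ≤ 2 * n) (hn : 0 < n) :
    (Subgroup.zpowers y).index ≤ 2 := by
  have := Subgroup.card_mul_index (Subgroup.zpowers y)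
  rw [Nat.card_zpowers] at this
  by_contra! h
  nlinarith

theorem commutator_eq_bot_of_comm {P : Type*} [Group P] (h : ∀ x y : P, x * y = y * x) :
    commutator P = ⊥ := by
  rw [eq_bot_iff, commutator_def, Subgroup.commutator_le]
  intro x _ y _
  rw [Subgroup.mem_bot, commutatorElement_eq_one_iff_mul_comm]
  exact h x y

/-- A finite `2`-group whose derived subgroup has index at most four contains a cyclic subgroup of
index at most two. -/
theorem exists_zpowers_index_le_two (n : ℕ) : ∀ (P : Type*) [Group P] [Finite P],
    Nat.card P = n → IsPGroup 2 P → (commutator P).index ≤ 4 →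
      ∃ r : P, (Subgroup.zpowers r).index ≤ 2 := by
  induction n using Nat.strong_induction_on with
  | _ n ih =>
  intro P _ _ hn hP hi
  by_cases h4 : Nat.card P ≤ 4
  · by_cases ht : Nontrivial P
    · obtain ⟨r, hr⟩ := exists_ne (1 : P)
      refine ⟨r, index_zpowers_le_two_of_card_le (n := 2) ?_ h4 (by norm_num)⟩
      have h1 : orderOf r ≠ 1 := by rwa [ne_eq, orderOf_eq_one_iff]
      have := orderOf_pos r
      omega
    · rw [not_nontrivial_iff_subsingleton] at ht
      exact ⟨1, by rw [Subgroup.index_eq_one.2 (Subsingleton.elim _ _)]; norm_num⟩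
  have hcb : commutator P ≠ ⊥ := by
    intro h
    rw [h, Subgroup.index_bot] at hi
    exact h4 hi
  obtain ⟨x, hx, hx1, hxc⟩ := hP.exists_mem_center_of_normal (commutator P) hcb
  obtain ⟨s, hs⟩ := IsPGroup.iff_orderOf.1 hP x
  have hs0 : s ≠ 0 := by
    rintro rfl
    rw [pow_zero, orderOf_eq_one_iff] at hs
    exact hx1 hs
  obtain ⟨s, rfl⟩ := Nat.exists_eq_succ_of_ne_zero hs0
  -- The induction divides by a central subgroup of order two inside the derived subgroup, so the
  -- index of the derived subgroup is unchanged.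
  set ν := x ^ 2 ^ s with hν
  have hν1 : ν ≠ 1 := by
    intro h
    have := Nat.le_of_dvd (by positivity) (orderOf_dvd_of_pow_eq_one h)
    rw [hs] at this
    exact absurd this (not_le.2 (Nat.pow_lt_pow_right (by norm_num) (Nat.lt_succ_self s)))
  have hν2 : ν ^ 2 = 1 := by
    rw [hν, ← pow_mul, ← pow_succ, ← hs, pow_orderOf_eq_one]
  have hνP : ν ∈ commutator P := pow_mem hx _
  have hνc : ν ∈ Subgroup.center P := pow_mem hxc _
  have hνo : orderOf ν = 2 := orderOf_eq_prime hν2 hν1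
  set N := Subgroup.zpowers ν with hN
  have hNmem : ∀ y, y ∈ N ↔ y = 1 ∨ y = ν := by
    intro y
    constructor
    · rintro ⟨i, rfl⟩
      change ν ^ i = 1 ∨ ν ^ i = ν
      rcases Int.even_or_odd' i with ⟨q, rfl | rfl⟩
      · left; rw [zpow_mul]; norm_cast; rw [hν2, one_zpow]
      · right; rw [zpow_add, zpow_mul]; norm_cast; rw [hν2, one_zpow]; simp
    · rintro (rfl | rfl)
      · exact one_mem _
      · exact Subgroup.mem_zpowers _
  have hNc : N ≤ Subgroup.center P := by rwa [hN, Subgroup.zpowers_le]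
  have : N.Normal := ⟨fun y hy g ↦ by
    rwa [Subgroup.mem_center_iff.1 (hNc hy) g, mul_inv_cancel_right]⟩
  let q := QuotientGroup.mk' N
  have hq : Function.Surjective q := QuotientGroup.mk'_surjective N
  have hqN : ∀ {y}, q y = 1 ↔ y ∈ N := QuotientGroup.eq_one_iff _
  have hcardq : Nat.card P = Nat.card (P ⧸ N) * 2 := by
    rw [Subgroup.card_eq_card_quotient_mul_card_subgroup N, hN, Nat.card_zpowers, hνo]
  have hqpos : 0 < Nat.card (P ⧸ N) := Nat.card_pos
  obtain ⟨rb, hrb⟩ := ih (Nat.card (P ⧸ N)) (by omega) (P ⧸ N) rfl (hP.to_quotient N) (by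
    have : commutator (P ⧸ N) = (commutator P).map q := by
      rw [commutator_def, commutator_def, Subgroup.map_commutator,
        Subgroup.map_top_of_surjective q hq]
    rw [this, Subgroup.index_map_eq _ hq]
    · exact hi
    · rw [QuotientGroup.ker_mk', hN, Subgroup.zpowers_le]
      exact hνP)
  obtain ⟨r, rfl⟩ := hq rb
  let B : Subgroup P := (Subgroup.zpowers (q r)).comap q
  have hBi : B.index = (Subgroup.zpowers (q r)).index := Subgroup.index_comap_of_surjective _ hq
  have hBform : ∀ y ∈ B, ∃ (i : ℤ) (w : P), w ∈ Subgroup.center P ∧ y = r ^ i * w := by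
    intro y hy
    obtain ⟨i, hi⟩ := Subgroup.mem_comap.1 hy
    change q r ^ i = q y at hi
    refine ⟨i, (r ^ i)⁻¹ * y, hNc (hqN.1 ?_), by group⟩
    rw [map_mul, map_inv, map_zpow, hi, inv_mul_cancel]
  have hBcomm : ∀ x ∈ B, ∀ y ∈ B, x * y = y * x := by
    intro x hx y hy
    obtain ⟨i, w, hw, rfl⟩ := hBform x hx
    obtain ⟨j, v, hv, rfl⟩ := hBform y hy
    have h1 : ∀ g, Commute g w := fun g ↦ Subgroup.mem_center_iff.1 hw g
    have h2 : ∀ g, Commute g v := fun g ↦ Subgroup.mem_center_iff.1 hv g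
    exact ((((Commute.refl r).zpow_zpow i j).mul_left (h1 _).symm).mul_right (h2 _)).eq
  have hBi2 : B.index = 2 := by
    have h0 : B.index ≠ 0 := Subgroup.index_ne_zero_of_finite
    have h1 : B.index ≠ 1 := by
      rw [ne_eq, Subgroup.index_eq_one]
      intro h
      exact hcb (commutator_eq_bot_of_comm fun x y ↦ hBcomm x (h ▸ trivial) y (h ▸ trivial))
    omega
  have : B.Normal := Subgroup.normal_of_index_eq_two hBi2
  obtain ⟨a, ha⟩ : ∃ a, a ∉ B := by
    by_contra! h
    rw [(Subgroup.index_eq_one).2 (eq_top_iff.2 fun x _ ↦ h x)] at hBi2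
    omega
  have ha2 : a ^ 2 ∈ B := Subgroup.sq_mem_of_index_two hBi2 a
  have hrB : r ∈ B := Subgroup.mem_comap.2 (Subgroup.mem_zpowers _)
  let φ := commutatorHom B hBcomm a
  have hcardB : Nat.card B * 2 = Nat.card P := by rw [← hBi2, Subgroup.card_mul_index]
  have hrange : Nat.card (commutator P) ≤ Nat.card φ.range :=
    Nat.card_le_card_of_injective _
      (Subgroup.inclusion_injective (commutator_le_range_commutatorHom hBcomm hBi2 ha))
  -- |B| = |P|/2 ≤ 2|P'| and |P'| is at most the order of the image of φ. Thus a centralizes at most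
  -- two elements of B, and these are 1 and ν.
  have hker : Nat.card φ.ker ≤ 2 := by
    have h1 : Nat.card φ.ker * Nat.card φ.range = Nat.card B := by
      rw [← Subgroup.index_ker, Subgroup.card_mul_index]
    have h2 := Subgroup.card_mul_index (commutator P)
    have h3 : 0 < Nat.card (commutator P) := Nat.card_pos
    by_contra! h
    nlinarith
  have hfix : ∀ y ∈ B, a * y = y * a → y ∈ N := by
    intro y hy hay
    rw [hNmem]
    by_contra! hne
    have hνB : ν ∈ B := Subgroup.mem_comap.2 (by
      rw [hqN.2 (Subgroup.mem_zpowers ν)]; exact one_mem _)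
    have := Fintype.ofFinite φ.ker
    rw [Nat.card_eq_fintype_card, ← not_lt, Fintype.two_lt_card_iff] at hker
    refine hker ⟨1, ⟨⟨ν, hνB⟩, (mem_ker_commutatorHom hBcomm).2 (Subgroup.mem_center_iff.1 hνc a)⟩,
      ⟨⟨y, hy⟩, (mem_ker_commutatorHom hBcomm).2 hay⟩, fun h ↦ hν1 ?_, fun h ↦ hne.1 ?_,
      fun h ↦ hne.2 ?_⟩
    all_goals exact (congrArg (fun t : φ.ker ↦ ((t : B) : P)) h).symm
  obtain ⟨κ, hκ⟩ := IsPGroup.iff_orderOf.1 (hP.to_quotient N) (q r)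
  have hcardP : Nat.card P = 2 ^ κ * 4 := by
    have h1 := Subgroup.card_mul_index (Subgroup.zpowers (q r))
    rw [Nat.card_zpowers, hκ, ← hBi, hBi2] at h1
    omega
  have hrK : r ^ 2 ^ κ ∈ N := by
    rw [← hqN, map_pow, ← hκ, pow_orderOf_eq_one]
  rw [hNmem] at hrK
  -- If r^(2^κ) = ν, then r generates B. Otherwise B splits over N, and only |P| = 8 is possible.
  rcases hrK with hrK | hrK
  · have hκ0 : κ ≠ 0 := by
      rintro rfl
      omega
    obtain ⟨κ, rfl⟩ := Nat.exists_eq_succ_of_ne_zero hκ0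
    rcases Nat.eq_zero_or_pos κ with rfl | hκpos
    -- Here |P| = 8 and P is not abelian, so it does not have exponent two; an element of order at
    -- least four generates a subgroup of index at most two.
    · obtain ⟨y, hy⟩ : ∃ y : P, y ^ 2 ≠ 1 := by
        by_contra! h
        have hinv : ∀ y : P, y⁻¹ = y := fun y ↦ by
          rw [inv_eq_iff_mul_eq_one, ← pow_two]; exact h y
        refine hcb (commutator_eq_bot_of_comm fun x y ↦ ?_)
        rw [← hinv (x * y), mul_inv_rev, hinv, hinv]
      refine ⟨y, index_zpowers_le_two_of_card_le (n := 4) ?_ (by omega) (by norm_num)⟩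
      obtain ⟨t, ht⟩ := IsPGroup.iff_orderOf.1 hP y
      have : 2 ≤ t := by
        by_contra! hlt
        apply hy
        rw [← orderOf_dvd_iff_pow_eq_one, ht]
        exact pow_dvd_pow 2 (by omega : t ≤ 1)
      rw [ht]
      exact (pow_le_pow_right₀ (by norm_num) this : 2 ^ 2 ≤ 2 ^ t)
    · exfalso
      obtain ⟨μ, rfl⟩ := Nat.exists_eq_succ_of_ne_zero hκpos.ne'
      -- The norm w lies in N, so a inverts r up to w with w² = 1. Then a inverts, hence fixes, the
      -- involution r^(2^(κ-1)), which must lie in N, against the order of r modulo N. An even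
      -- exponent is needed to kill w, hence the separate case of order eight.
      set w := r * (a * r * a⁻¹) with hw
      have hwN : w ∈ N := hfix w
        (mul_mem hrB (Subgroup.Normal.conj_mem inferInstance _ hrB a))
        (commute_conj_mul_self hBcomm ha2 hrB)
      have hw2 : w ^ 2 = 1 := by
        rcases (hNmem w).1 hwN with h | h <;> rw [h]
        · simp
        · exact hν2
      have hconj : a * r * a⁻¹ = r⁻¹ * w := by rw [hw]; group
      have hcw : Commute r⁻¹ w := Subgroup.mem_center_iff.1 (hNc hwN) r⁻¹
      have hhalf : a * r ^ 2 ^ (μ + 1) * a⁻¹ = r ^ 2 ^ (μ + 1) := by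
        rw [← conj_pow, hconj, hcw.mul_pow, pow_succ' 2 μ, pow_mul w, hw2, one_pow, mul_one,
          inv_pow, inv_eq_iff_mul_eq_one, ← pow_add]
        rw [← hrK]; congr 1; change _ = 2 ^ (μ + 1 + 1); ring
      have hmem := hfix (r ^ 2 ^ (μ + 1)) (pow_mem hrB _) (mul_inv_eq_iff_eq_mul.1 hhalf)
      rw [← hqN, map_pow] at hmem
      have := Nat.le_of_dvd (by positivity) (orderOf_dvd_of_pow_eq_one hmem)
      rw [hκ] at this
      exact absurd this (not_le.2 (Nat.pow_lt_pow_right (by norm_num) (Nat.lt_succ_self _)))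
  · refine ⟨r, index_zpowers_le_two_of_card_le (n := 2 ^ (κ + 1)) ?_ ?_ (by positivity)⟩
    · obtain ⟨t, ht⟩ := IsPGroup.iff_orderOf.1 hP r
      rw [ht]
      apply pow_le_pow_right₀ (by norm_num)
      by_contra! hlt
      apply hν1
      rw [← hrK, ← orderOf_dvd_iff_pow_eq_one, ht]
      exact pow_dvd_pow 2 (by omega)
    · rw [hcardP, pow_succ]; omega

end Taussky

/-! ### Recognizing the family by the index of G'Z(G) -/

section Recognition

variable {G : Type*} [Group G]

theorem IsDihedralTwoGroup.exists_generators (h : IsDihedralTwoGroup (G ⧸ Subgroup.center G)) :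
    (¬ ∀ x y : G, x * y = y * x) ∧ ∃ a b : G, a ^ 2 ∈ Subgroup.center G ∧
      b ^ 2 ∈ Subgroup.center G ∧ Subgroup.closure {a, b} ⊔ Subgroup.center G = ⊤ := by
  obtain ⟨_, _, x, y, hx, hy, hxy, hgen⟩ := h
  have hq : Function.Surjective (QuotientGroup.mk' (Subgroup.center G)) :=
    QuotientGroup.mk'_surjective _
  have hmem : ∀ g : G, orderOf (QuotientGroup.mk' (Subgroup.center G) g) = 2 →
      g ^ 2 ∈ Subgroup.center G := by
    intro g hg
    have := pow_orderOf_eq_one (QuotientGroup.mk' (Subgroup.center G) g)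
    rwa [hg, ← map_pow, ← MonoidHom.mem_ker, QuotientGroup.ker_mk'] at this
  obtain ⟨a, rfl⟩ := hq x
  obtain ⟨b, rfl⟩ := hq y
  refine ⟨fun hc ↦ ?_, a, b, hmem a hx, hmem b hy, ?_⟩
  · have ha : a ∈ Subgroup.center G := Subgroup.mem_center_iff.2 fun g ↦ hc g a
    rw [show QuotientGroup.mk' (Subgroup.center G) a = 1 from (QuotientGroup.eq_one_iff a).2 ha,
      orderOf_one] at hx
    norm_num at hx
  · have h1 : (Subgroup.closure {a, b}).map (QuotientGroup.mk' (Subgroup.center G)) = ⊤ := by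
      rw [MonoidHom.map_closure, Set.image_pair]; exact hgen
    have h2 := congrArg (Subgroup.comap (QuotientGroup.mk' (Subgroup.center G))) h1
    rwa [Subgroup.comap_map_eq, QuotientGroup.ker_mk', Subgroup.comap_top] at h2

/-- Taussky's theorem for G/Z(G) gives r such that B = ⟨r⟩Z(G) is abelian of index two. For a
outside B, a² commutes with a and with B, so it is central; and (a⁻¹r)² is a⁻² times the norm of r,
which is central for the same reason. -/
theorem exists_generators_of_index_le_four [Finite G] (hG : IsPGroup 2 G)
    (hne : ¬ ∀ x y : G, x * y = y * x)
    (hi : (commutator G ⊔ Subgroup.center G).index ≤ 4) :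
    ∃ a b : G, a ^ 2 ∈ Subgroup.center G ∧ b ^ 2 ∈ Subgroup.center G ∧
      Subgroup.closure {a, b} ⊔ Subgroup.center G = ⊤ := by
  let q := QuotientGroup.mk' (Subgroup.center G)
  have hq : Function.Surjective q := QuotientGroup.mk'_surjective _
  obtain ⟨rb, hrb⟩ := exists_zpowers_index_le_two _ (G ⧸ Subgroup.center G) rfl
    (hG.to_quotient _) (by
      have : commutator (G ⧸ Subgroup.center G) = (commutator G).map q := by
        rw [commutator_def, commutator_def, Subgroup.map_commutator,
          Subgroup.map_top_of_surjective q hq]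
      rw [this, Subgroup.index_map, MonoidHom.range_eq_top.2 hq, Subgroup.index_top, mul_one,
        QuotientGroup.ker_mk']
      exact hi)
  obtain ⟨r, rfl⟩ := hq rb
  let B : Subgroup G := (Subgroup.zpowers (q r)).comap q
  have hBi : B.index = (Subgroup.zpowers (q r)).index := Subgroup.index_comap_of_surjective _ hq
  have hBform : ∀ y ∈ B, ∃ (i : ℤ) (w : G), w ∈ Subgroup.center G ∧ y = r ^ i * w := by
    intro y hy
    obtain ⟨i, hi⟩ := Subgroup.mem_comap.1 hy
    change q r ^ i = q y at hi
    refine ⟨i, (r ^ i)⁻¹ * y, (QuotientGroup.eq_one_iff _).1 ?_, by group⟩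
    change q _ = 1
    rw [map_mul, map_inv, map_zpow, hi, inv_mul_cancel]
  have hBcomm : ∀ x ∈ B, ∀ y ∈ B, x * y = y * x := by
    intro x hx y hy
    obtain ⟨i, w, hw, rfl⟩ := hBform x hx
    obtain ⟨j, v, hv, rfl⟩ := hBform y hy
    have h1 : ∀ g, Commute g w := fun g ↦ Subgroup.mem_center_iff.1 hw g
    have h2 : ∀ g, Commute g v := fun g ↦ Subgroup.mem_center_iff.1 hv g
    exact ((((Commute.refl r).zpow_zpow i j).mul_left (h1 _).symm).mul_right (h2 _)).eq
  have hBi2 : B.index = 2 := by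
    have h0 : B.index ≠ 0 := Subgroup.index_ne_zero_of_finite
    have h1 : B.index ≠ 1 := by
      rw [ne_eq, Subgroup.index_eq_one]
      intro h
      exact hne fun x y ↦ hBcomm x (h ▸ trivial) y (h ▸ trivial)
    omega
  have : B.Normal := Subgroup.normal_of_index_eq_two hBi2
  obtain ⟨a, ha⟩ : ∃ a, a ∉ B := by
    by_contra! h
    rw [(Subgroup.index_eq_one).2 (eq_top_iff.2 fun x _ ↦ h x)] at hBi2
    omega
  have ha2 : a ^ 2 ∈ B := Subgroup.sq_mem_of_index_two hBi2 a
  have hrB : r ∈ B := Subgroup.mem_comap.2 (Subgroup.mem_zpowers _)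
  have hform : ∀ g, ∃ x ∈ B, g = x ∨ g = x * a := by
    intro g
    by_cases hg : g ∈ B
    · exact ⟨g, hg, Or.inl rfl⟩
    · refine ⟨g * a⁻¹, ?_, Or.inr (by simp)⟩
      rw [Subgroup.mul_mem_iff_of_index_two hBi2]
      simp [hg, ha]
  have hcent : ∀ y ∈ B, a * y = y * a → y ∈ Subgroup.center G := by
    intro y hy hay
    rw [Subgroup.mem_center_iff]
    intro g
    obtain ⟨x, hx, rfl | rfl⟩ := hform g
    · exact hBcomm _ hx _ hy
    · rw [mul_assoc, hay, ← mul_assoc, hBcomm _ hx _ hy, mul_assoc]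
  have ha2c : a ^ 2 ∈ Subgroup.center G := hcent _ ha2 ((Commute.refl a).pow_right 2)
  refine ⟨a, a⁻¹ * r, ha2c, ?_, ?_⟩
  · have h1 : (a⁻¹ * r) ^ 2 = (a ^ 2)⁻¹ * ((a * r * a⁻¹) * r) := by
      rw [pow_two, pow_two]; group
    have hc : a * r * a⁻¹ ∈ B := Subgroup.Normal.conj_mem inferInstance _ hrB a
    rw [h1, hBcomm _ hc _ hrB]
    exact mul_mem (inv_mem ha2c) (hcent _ (mul_mem hrB hc) (commute_conj_mul_self hBcomm ha2 hrB))
  · rw [eq_top_iff]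
    intro g _
    have ma : a ∈ Subgroup.closure {a, a⁻¹ * r} ⊔ Subgroup.center G :=
      Subgroup.mem_sup_left (Subgroup.subset_closure (by simp))
    have mr : r ∈ Subgroup.closure {a, a⁻¹ * r} ⊔ Subgroup.center G := by
      have : a⁻¹ * r ∈ Subgroup.closure {a, a⁻¹ * r} ⊔ Subgroup.center G :=
        Subgroup.mem_sup_left (Subgroup.subset_closure (by simp))
      simpa using mul_mem ma this
    have mB : ∀ x ∈ B, x ∈ Subgroup.closure {a, a⁻¹ * r} ⊔ Subgroup.center G := by
      intro x hx
      obtain ⟨i, w, hw, rfl⟩ := hBform x hx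
      exact mul_mem (zpow_mem mr i) (Subgroup.mem_sup_right hw)
    obtain ⟨x, hx, rfl | rfl⟩ := hform g
    · exact mB _ hx
    · exact mul_mem (mB _ hx) ma

namespace IsDihedralExt

variable {k l e f : ℕ} {a b z : G}

open scoped commutatorElement in
-- Modulo G'Z(G) the group is abelian and generated by the images of a and b, whose squares die.
theorem index_commutator_sup_center_le (h : IsDihedralExt k l e f a b z) :
    (commutator G ⊔ Subgroup.center G).index ≤ 4 := by
  set K := commutator G ⊔ Subgroup.center G
  have hzK : ∀ j : ℤ, z ^ j ∈ K := fun j ↦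
    Subgroup.mem_sup_right (h.center_eq ▸ ⟨j, rfl⟩)
  have hcomm : ∀ x y : G, ⁅x, y⁆ ∈ K := fun x y ↦
    Subgroup.mem_sup_left (Subgroup.commutator_mem_commutator (Subgroup.mem_top x) (Subgroup.mem_top y))
  have : K.Normal := inferInstance
  let q := QuotientGroup.mk' K
  have hz : ∀ j : ℤ, q (z ^ j) = 1 := fun j ↦ (QuotientGroup.eq_one_iff _).2 (hzK j)
  have hcq : q (a * b) ^ 2 = 1 := by
    have h1 : (a * b) ^ 2 = ⁅a, b⁆ * z ^ ((e + f : ℕ) : ℤ) := by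
      rw [zpow_natCast, pow_add, ← h.b_sq, commutatorElement_def]
      have : Commute (z ^ e) b := h.comm_b.pow_left e
      rw [pow_two b, ← mul_assoc (z ^ e), this.eq, ← h.a_sq]
      simp only [pow_two]; group
    rw [← map_pow, h1, map_mul, hz, mul_one]
    exact (QuotientGroup.eq_one_iff _).2 (hcomm a b)
  have hci : ∀ i : ℤ, q (a * b) ^ i = 1 ∨ q (a * b) ^ i = q (a * b) := by
    intro i
    rcases Int.even_or_odd' i with ⟨s, rfl | rfl⟩
    · left; rw [zpow_mul]; norm_cast; rw [hcq, one_zpow]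
    · right; rw [zpow_add, zpow_mul]; norm_cast; rw [hcq, one_zpow]; simp
  let F : Fin 2 × Fin 2 → G ⧸ K := fun p ↦ q (a * b) ^ p.1.val * q a ^ p.2.val
  have hF : Function.Surjective F := by
    intro x
    obtain ⟨g, rfl⟩ := QuotientGroup.mk'_surjective K x
    change ∃ y, F y = q g
    obtain ⟨i, j, rfl | rfl⟩ := h.exists_zpow_form g
    · rw [map_mul, hz, map_zpow]
      rcases hci i with hi | hi <;> rw [hi]
      · exact ⟨(0, 0), by simp [F]⟩
      · exact ⟨(1, 0), by simp [F]⟩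
    · rw [map_mul, map_mul, hz, map_zpow]
      rcases hci i with hi | hi <;> rw [hi]
      · exact ⟨(0, 1), by simp [F]⟩
      · exact ⟨(1, 1), by simp [F]⟩
  have := Nat.card_le_card_of_surjective F hF
  simpa [Subgroup.index] using this

end IsDihedralExt

end Recognition

/-! ### Class functions and Frobenius powers in characteristic two -/

section GroupAlgebra

namespace MonoidAlgebra

variable {F : Type*} [Field F]

instance charP_two {G : Type*} [Monoid G] [CharP F 2] : CharP (MonoidAlgebra F G) 2 :=
  charP_of_injective_algebraMap (FaithfulSMul.algebraMap_injective F (MonoidAlgebra F G)) 2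

theorem add_self_of_charTwo [CharP F 2] {V : Type*} [AddCommGroup V] [Module F V] (v : V) :
    v + v = 0 := by
  rw [← two_smul F v, CharTwo.two_eq_zero, zero_smul]

/-- The linear extension of a function on the basis `G` of the group algebra. -/
noncomputable def wt {G V : Type*} [AddCommGroup V] [Module F V] (h : G → V) :
    MonoidAlgebra F G →ₗ[F] V :=
  Finsupp.linearCombination F h ∘ₗ (coeffLinearEquiv F).toLinearMap

section wt

variable {G V : Type*} [AddCommGroup V] [Module F V] (h : G → V)

@[simp]
theorem wt_single (g : G) (r : F) : wt h (single g r) = r • h g := by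
  simp [wt]

theorem wt_apply [Fintype G] (x : MonoidAlgebra F G) : wt h x = ∑ g, x.coeff g • h g := by
  simp [wt, Finsupp.linearCombination_apply, Finsupp.sum_fintype]

theorem linearMap_ext {f f' : MonoidAlgebra F G →ₗ[F] V}
    (hf : ∀ g, f (single g 1) = f' (single g 1)) : f = f' := by
  refine LinearMap.ext fun x ↦ ?_
  have h1 : f ∘ₗ (coeffLinearEquiv F).symm.toLinearMap =
      f' ∘ₗ (coeffLinearEquiv F).symm.toLinearMap := by
    refine Finsupp.lhom_ext' fun g ↦ LinearMap.ext_ring ?_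
    exact hf g
  exact LinearMap.congr_fun h1 x.coeff

theorem eq_wt (f : MonoidAlgebra F G →ₗ[F] V) : f = wt fun g ↦ f (single g 1) :=
  linearMap_ext fun g ↦ by simp

end wt

section ClassFunction

variable {G : Type*} [Group G]

/-- A noncentral conjugacy class of a 2-group has even size, so its contribution vanishes in
characteristic two. -/
theorem sum_eq_sum_center [CharP F 2] [Fintype G] [Fintype (Subgroup.center G)] (hG : IsPGroup 2 G) {V : Type*} [AddCommGroup V] [Module F V]
    (k : G → V) (hk : ∀ g x, k (g * x * g⁻¹) = k x) :
    ∑ x, k x = ∑ x : Subgroup.center G, k x := by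
  classical
  have h0 : ∑ x : Subgroup.center G, k x = ∑ x, if x ∈ Subgroup.center G then k x else 0 := by
    rw [← Finset.sum_filter]
    exact (Finset.sum_subtype _ (by simp) k).symm
  rw [h0, ← Finset.sum_fiberwise Finset.univ ConjClasses.mk k,
    ← Finset.sum_fiberwise Finset.univ ConjClasses.mk
      (fun x ↦ if x ∈ Subgroup.center G then k x else 0)]
  refine Finset.sum_congr rfl fun C _ ↦ ?_
  obtain ⟨x, rfl⟩ := ConjClasses.exists_rep C
  have hconj : ∀ y ∈ Finset.univ.filter (fun y ↦ ConjClasses.mk y = ConjClasses.mk x),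
      ∃ g, g * x * g⁻¹ = y := by
    intro y hy
    rw [Finset.mem_filter, ConjClasses.mk_eq_mk_iff_isConj] at hy
    exact isConj_iff.1 hy.2.symm
  by_cases hx : x ∈ Subgroup.center G
  · refine Finset.sum_congr rfl fun y hy ↦ ?_
    obtain ⟨g, rfl⟩ := hconj y hy
    rw [if_pos]
    exact Subgroup.Normal.conj_mem inferInstance _ hx g
  · have h1 : ∀ y ∈ Finset.univ.filter (fun y ↦ ConjClasses.mk y = ConjClasses.mk x),
        (if y ∈ Subgroup.center G then k y else 0) = 0 := by
      intro y hy
      obtain ⟨g, rfl⟩ := hconj y hy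
      refine if_neg fun h ↦ hx ?_
      have := Subgroup.Normal.conj_mem inferInstance _ h g⁻¹
      simpa [mul_assoc] using this
    rw [Finset.sum_eq_zero h1]
    have h2 : ∀ y ∈ Finset.univ.filter (fun y ↦ ConjClasses.mk y = ConjClasses.mk x),
        k y = k x := by
      intro y hy
      obtain ⟨g, rfl⟩ := hconj y hy
      exact hk g x
    rw [Finset.sum_congr rfl h2, Finset.sum_const]
    have hG' : IsPGroup 2 (ConjAct G) := hG
    obtain ⟨n, hn⟩ := hG'.card_orbit x
    have hcard : (Finset.univ.filter (fun y ↦ ConjClasses.mk y = ConjClasses.mk x)).card =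
        2 ^ n := by
      rw [← hn]
      refine (Nat.subtype_card _ fun y ↦ ?_).symm
      rw [Finset.mem_filter, ConjAct.mem_orbit_conjAct, ConjClasses.mk_eq_mk_iff_isConj]
      simp
    rcases Nat.eq_zero_or_pos n with rfl | hn0
    · exfalso
      apply hx
      rw [pow_zero] at hn
      rw [Subgroup.mem_center_iff]
      intro g
      have : Subsingleton (MulAction.orbit (ConjAct G) x) := (Nat.card_eq_one_iff_unique.1 hn).1
      have h3 : g * x * g⁻¹ ∈ MulAction.orbit (ConjAct G) x := ⟨ConjAct.toConjAct g, rfl⟩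
      have h4 := congrArg Subtype.val
        (Subsingleton.elim (⟨_, h3⟩ : MulAction.orbit (ConjAct G) x) ⟨x, MulAction.mem_orbit_self x⟩)
      exact mul_inv_eq_iff_eq_mul.1 h4
    · obtain ⟨n, rfl⟩ := Nat.exists_eq_succ_of_ne_zero hn0.ne'
      rw [hcard, pow_succ, mul_smul, two_smul, add_self_of_charTwo (F := F), smul_zero]

theorem coeff_conj_of_mem_center {x : MonoidAlgebra F G}
    (hx : x ∈ Subalgebra.center F (MonoidAlgebra F G)) (g y : G) :
    x.coeff (g * y * g⁻¹) = x.coeff y := by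
  have h := Subalgebra.mem_center_iff.1 hx (single g 1)
  have h1 := congrArg (fun t : MonoidAlgebra F G ↦ t.coeff (g * y)) h
  simpa using h1.symm

theorem wt_of_mem_center [CharP F 2] [Fintype G] [Fintype (Subgroup.center G)] (hG : IsPGroup 2 G) {V : Type*} [AddCommGroup V] [Module F V]
    {x : MonoidAlgebra F G} (hx : x ∈ Subalgebra.center F (MonoidAlgebra F G)) {h : G → V}
    (hh : ∀ g y, h (g * y * g⁻¹) = h y) :
    wt h x = ∑ z : Subgroup.center G, x.coeff z • h z := by
  rw [wt_apply, sum_eq_sum_center (F := F) hG]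
  intro g y
  rw [coeff_conj_of_mem_center hx, hh]

end ClassFunction

theorem commute_of_comm {A : Type*} [Group A] (hc : ∀ s t : A, s * t = t * s)
    (x y : MonoidAlgebra F A) : Commute x y :=
  letI : CommGroup A := { mul_comm := hc }
  mul_comm x y

/-- Iterated Frobenius is additive on a commutative group algebra and sends each basis element to 1,
leaving only the power of the augmentation. -/
theorem pow_eq_algebraMap_of_comm [CharP F 2] {A : Type*} [Group A]
    (hc : ∀ s t : A, s * t = t * s) {j : ℕ} (hA : ∀ s : A, s ^ 2 ^ j = 1) (x : MonoidAlgebra F A) :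
    x ^ 2 ^ j = algebraMap F _ (wt (fun _ ↦ (1 : F)) x ^ 2 ^ j) := by
  induction x using induction_on with
  | of m => simp [of_apply, hA, single_pow]
  | add x y hx hy =>
    rw [add_pow_char_pow_of_commute _ _ (commute_of_comm hc x y), hx, hy, map_add, add_pow_char_pow,
      map_add]
  | smul r x hx =>
    rw [smul_pow, hx, map_smul, smul_eq_mul, mul_pow, map_mul, Algebra.smul_def]

end MonoidAlgebra

end GroupAlgebra

/-! ### The center of the group is seen by the algebra -/

section Invariants

/-- The span of the additive commutators of an algebra. -/
def commutatorSpan (F B : Type*) [CommRing F] [Ring B] [Algebra F B] : Submodule F B :=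
  Submodule.span F (Set.range fun p : B × B ↦ p.1 * p.2 - p.2 * p.1)

section commutatorSpan

variable {F B : Type*} [CommRing F] [Ring B] [Algebra F B]

theorem mul_sub_mul_mem_commutatorSpan (x y : B) : x * y - y * x ∈ commutatorSpan F B :=
  Submodule.subset_span ⟨(x, y), rfl⟩

theorem mul_mem_commutatorSpan {z t : B} (hz : z ∈ Subalgebra.center F B)
    (ht : t ∈ commutatorSpan F B) : z * t ∈ commutatorSpan F B := by
  rw [Subalgebra.mem_center_iff] at hz
  induction ht using Submodule.span_induction with
  | mem t ht =>
    obtain ⟨⟨x, y⟩, rfl⟩ := ht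
    have : z * (x * y - y * x) = (z * x) * y - y * (z * x) := by
      rw [mul_sub, ← mul_assoc y, hz y]; simp only [mul_assoc]
    change z * (x * y - y * x) ∈ _
    rw [this]
    exact mul_sub_mul_mem_commutatorSpan _ _
  | zero => rw [mul_zero]; exact zero_mem _
  | add x y _ _ hx hy => rw [mul_add]; exact add_mem hx hy
  | smul r x _ hx => rw [mul_smul_comm]; exact Submodule.smul_mem _ _ hx

theorem AlgEquiv.map_mem_commutatorSpan {B' : Type*} [Ring B'] [Algebra F B'] (φ : B ≃ₐ[F] B')
    {t : B} (ht : t ∈ commutatorSpan F B) : φ t ∈ commutatorSpan F B' := by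
  induction ht using Submodule.span_induction with
  | mem t ht =>
    obtain ⟨⟨x, y⟩, rfl⟩ := ht
    simp only [map_sub, map_mul]
    exact mul_sub_mul_mem_commutatorSpan _ _
  | zero => rw [map_zero]; exact zero_mem _
  | add x y _ _ hx hy => rw [map_add]; exact add_mem hx hy
  | smul r x _ hx => rw [map_smul]; exact Submodule.smul_mem _ _ hx

theorem AlgEquiv.map_mem_center {B' : Type*} [Ring B'] [Algebra F B'] (φ : B ≃ₐ[F] B')
    {t : B} (ht : t ∈ Subalgebra.center F B) : φ t ∈ Subalgebra.center F B' := by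
  rw [Subalgebra.mem_center_iff] at ht ⊢
  intro b
  obtain ⟨b, rfl⟩ := φ.surjective b
  rw [← map_mul, ht, map_mul]

end commutatorSpan

namespace MonoidAlgebra

variable {F : Type*} [Field F] {G : Type*} [Group G]

/-- The coefficient of a product at a central element does not depend on the order of the factors,
because gh = c forces hg = c. -/
theorem coeff_eq_zero_of_mem_commutatorSpan [Finite G] {t : MonoidAlgebra F G}
    (ht : t ∈ commutatorSpan F (MonoidAlgebra F G)) {c : G} (hc : c ∈ Subgroup.center G) :
    t.coeff c = 0 := by
  have := Fintype.ofFinite G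
  induction ht using Submodule.span_induction with
  | mem t ht =>
    obtain ⟨⟨x, y⟩, rfl⟩ := ht
    change (x * y - y * x).coeff c = 0
    rw [coeff_sub, Finsupp.sub_apply, coeff_mul_apply_left, coeff_mul_apply_right, sub_eq_zero]
    refine Finsupp.sum_congr fun h _ ↦ ?_
    rw [Subgroup.mem_center_iff.1 hc, mul_comm]
  | zero => simp
  | add x y _ _ hx hy => simp [hx, hy]
  | smul r x _ hx => simp [hx]

/-- The inclusion of the group algebra of the center. -/
noncomputable abbrev centerHom (F G : Type*) [Field F] [Group G] :
    MonoidAlgebra F (Subgroup.center G) →ₐ[F] MonoidAlgebra F G :=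
  mapDomainAlgHom F F (Subgroup.center G).subtype

theorem centerHom_single (z : Subgroup.center G) (r : F) :
    centerHom F G (single z r) = single (z : G) r := by
  simp [centerHom]

theorem centerHom_mem_center (y : MonoidAlgebra F (Subgroup.center G)) :
    centerHom F G y ∈ Subalgebra.center F (MonoidAlgebra F G) := by
  induction y using induction_on with
  | of m =>
    rw [of_apply, centerHom_single, Subalgebra.mem_center_iff]
    intro x
    ext h
    have := Subgroup.mem_center_iff.1 (inv_mem m.2) h
    simp [this]
  | add x y hx hy => rw [map_add]; exact add_mem hx hy
  | smul r x hx => rw [map_smul]; exact Subalgebra.smul_mem _ hx r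

theorem coeff_centerHom (y : MonoidAlgebra F (Subgroup.center G)) (z : Subgroup.center G) :
    (centerHom F G y).coeff z = y.coeff z := by
  simp only [centerHom, mapDomainAlgHom_apply]
  exact Finsupp.mapDomain_apply Subtype.val_injective _ _

theorem algebraMap_coeff_of_ne_one {g : G} (hg : g ≠ 1) (r : F) :
    (algebraMap F (MonoidAlgebra F G) r).coeff g = 0 := by
  classical
  simp [coe_algebraMap, hg.symm]

variable [Finite G]

/-- Conjugate group elements agree modulo additive commutators, so modulo these the noncentral class
sums of a central element disappear. -/
theorem exists_centerHom_sub_mem_commutatorSpan [CharP F 2] (hG : IsPGroup 2 G)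
    {x : MonoidAlgebra F G} (hx : x ∈ Subalgebra.center F (MonoidAlgebra F G)) :
    ∃ y, x - centerHom F G y ∈ commutatorSpan F (MonoidAlgebra F G) ∧
      ∀ z : Subgroup.center G, y.coeff z = x.coeff z := by
  classical
  have := Fintype.ofFinite G
  have := Fintype.ofFinite (Subgroup.center G)
  let T := commutatorSpan F (MonoidAlgebra F G)
  let h : G → MonoidAlgebra F G ⧸ T := fun g ↦ T.mkQ (single g 1)
  have hh : ∀ g y, h (g * y * g⁻¹) = h y := by
    intro g y
    have h1 := mul_sub_mul_mem_commutatorSpan (F := F) (single (g * y) 1 : MonoidAlgebra F G)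
      (single g⁻¹ 1)
    simp only [single_mul_single, mul_one, inv_mul_cancel_left] at h1
    exact (Submodule.Quotient.eq T).2 h1
  have h2 : wt h = T.mkQ := by
    rw [eq_wt T.mkQ]
  have h3 := wt_of_mem_center hG hx hh
  rw [h2] at h3
  refine ⟨∑ z : Subgroup.center G, single z (x.coeff z), ?_, ?_⟩
  · rw [← Submodule.Quotient.eq]
    change T.mkQ x = T.mkQ _
    rw [h3, map_sum, map_sum]
    refine Finset.sum_congr rfl fun z _ ↦ ?_
    rw [centerHom_single, ← map_smul]
    simp [smul_single]
  · intro z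
    simp [coeff_sum, Finsupp.single_apply]

variable {H : Type*} [Group H] [Finite H]

/-- The algebra of Z(G) meets the commutator span trivially, and its image in the center of FH is
determined modulo commutators by the coefficients on Z(H). Those coefficients therefore give an
injection. -/
theorem card_center_le [CharP F 2] (hH : IsPGroup 2 H)
    (φ : MonoidAlgebra F G ≃ₐ[F] MonoidAlgebra F H) :
    Nat.card (Subgroup.center G) ≤ Nat.card (Subgroup.center H) := by
  have := Fintype.ofFinite (Subgroup.center G)
  have := Fintype.ofFinite (Subgroup.center H)
  let E : MonoidAlgebra F (Subgroup.center G) →ₗ[F] (Subgroup.center H → F) :=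
    LinearMap.pi fun z ↦ Finsupp.lapply (z : H) ∘ₗ (coeffLinearEquiv F).toLinearMap ∘ₗ
      φ.toLinearMap ∘ₗ (centerHom F G).toLinearMap
  have hE : Function.Injective E := by
    rw [← LinearMap.ker_eq_bot, eq_bot_iff]
    intro u hu
    have hu' : ∀ z : Subgroup.center H, (φ (centerHom F G u)).coeff z = 0 := fun z ↦
      congrFun (LinearMap.mem_ker.1 hu) z
    obtain ⟨y, hy, hy'⟩ := exists_centerHom_sub_mem_commutatorSpan hH
      (φ.map_mem_center (centerHom_mem_center u))
    have hy0 : y = 0 := by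
      ext z
      rw [hy', hu']; rfl
    rw [hy0, map_zero, sub_zero] at hy
    have h1 := φ.symm.map_mem_commutatorSpan hy
    rw [AlgEquiv.symm_apply_apply] at h1
    rw [Submodule.mem_bot]
    ext z
    rw [← coeff_centerHom, coeff_eq_zero_of_mem_commutatorSpan h1 z.2]; rfl
  have h1 := LinearMap.finrank_le_finrank_of_injective hE
  rw [Module.finrank_fintype_fun_eq_card, (coeffLinearEquiv F).finrank_eq,
    Module.finrank_finsupp_self] at h1
  simpa only [Nat.card_eq_fintype_card] using h1

theorem card_eq (φ : MonoidAlgebra F G ≃ₐ[F] MonoidAlgebra F H) : Nat.card G = Nat.card H := by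
  have := Fintype.ofFinite G
  have := Fintype.ofFinite H
  have h1 := φ.toLinearEquiv.finrank_eq
  rw [(coeffLinearEquiv F).finrank_eq, (coeffLinearEquiv F).finrank_eq,
    Module.finrank_finsupp_self, Module.finrank_finsupp_self] at h1
  simpa only [Nat.card_eq_fintype_card] using h1

/-- If the center of `H` has exponent dividing `2 ^ j`, so does the center of `G`. -/
theorem center_pow_eq_one [CharP F 2] (hH : IsPGroup 2 H)
    (φ : MonoidAlgebra F G ≃ₐ[F] MonoidAlgebra F H) {j : ℕ}
    (hj : ∀ z : Subgroup.center H, z ^ 2 ^ j = 1) (z : Subgroup.center G) : z ^ 2 ^ j = 1 := by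
  have hz := φ.map_mem_center (centerHom_mem_center (single z (1 : F)))
  set x := φ (centerHom F G (single z (1 : F))) with hx
  obtain ⟨y, hy, -⟩ := exists_centerHom_sub_mem_commutatorSpan hH hz
  -- Central elements lying in the commutator span stay there under positive powers. So the 2^j-th
  -- power of the image of z is a scalar modulo commutators, and pulling this back contradicts the
  -- coefficient 1 at a central z^(2^j) ≠ 1.
  set x1 := x - centerHom F H y with hx1
  have hx1c : x1 ∈ Subalgebra.center F (MonoidAlgebra F H) :=
    sub_mem hz (centerHom_mem_center y)
  have hpow : ∀ n, x1 ^ (n + 1) ∈ commutatorSpan F (MonoidAlgebra F H) := by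
    intro n
    rw [pow_succ]
    exact mul_mem_commutatorSpan (pow_mem hx1c n) hy
  have hpow2 : x1 ^ 2 ^ j ∈ commutatorSpan F (MonoidAlgebra F H) := by
    obtain ⟨n, hn⟩ := Nat.exists_eq_succ_of_ne_zero (pow_ne_zero j (two_ne_zero (α := ℕ)))
    rw [hn]
    exact hpow n
  have hcomm : Commute x1 (centerHom F H y) :=
    Subalgebra.mem_center_iff.1 (centerHom_mem_center y) x1
  have hxp : x ^ 2 ^ j = x1 ^ 2 ^ j + algebraMap F _ (wt (fun _ ↦ (1 : F)) y ^ 2 ^ j) := by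
    have h1 : x = x1 + centerHom F H y := by rw [hx1, sub_add_cancel]
    rw [h1, add_pow_char_pow_of_commute _ _ hcomm, ← map_pow (centerHom F H),
      pow_eq_algebraMap_of_comm (fun s t ↦ Subtype.ext (Subgroup.mem_center_iff.1 t.2 s)) hj,
      AlgHom.commutes]
  by_contra hne
  have h2 := congrArg φ.symm hxp
  rw [map_add, map_pow, hx, AlgEquiv.symm_apply_apply, AlgEquiv.commutes, ← map_pow, single_pow,
    one_pow, centerHom_single] at h2
  have h3 := congrArg (fun t : MonoidAlgebra F G ↦ t.coeff ((z ^ 2 ^ j : Subgroup.center G) : G)) h2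
  have h4 : ((z ^ 2 ^ j : Subgroup.center G) : G) ≠ 1 := fun h ↦ hne (Subtype.ext h)
  have h5 := coeff_eq_zero_of_mem_commutatorSpan
    (φ.symm.map_mem_commutatorSpan hpow2) (z ^ 2 ^ j : Subgroup.center G).2
  simp only [coeff_add, Finsupp.add_apply, coeff_single, Finsupp.single_eq_same, h5,
    algebraMap_coeff_of_ne_one h4, add_zero] at h3
  exact one_ne_zero h3

/-- A 2-group of order 2^(j+1) with an element not killed by 2^j is cyclic, so equal orders and
transfer of exponents suffice. -/
theorem isCyclic_center [CharP F 2] (hG : IsPGroup 2 G) (hH : IsPGroup 2 H)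
    (φ : MonoidAlgebra F G ≃ₐ[F] MonoidAlgebra F H) (hc : IsCyclic (Subgroup.center G)) :
    IsCyclic (Subgroup.center H) := by
  have hcard : Nat.card (Subgroup.center G) = Nat.card (Subgroup.center H) :=
    le_antisymm (card_center_le hH φ) (card_center_le hG φ.symm)
  obtain ⟨m, hm⟩ := IsPGroup.iff_card.1 (hG.to_subgroup (Subgroup.center G))
  obtain ⟨z, hz⟩ := hc.exists_ofOrder_eq_natCard
  rcases Nat.eq_zero_or_pos m with rfl | hm0
  · rw [hcard, pow_zero, Nat.card_eq_one_iff_unique] at hm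
    have := hm.1
    exact isCyclic_of_subsingleton
  obtain ⟨j, rfl⟩ := Nat.exists_eq_succ_of_ne_zero hm0.ne'
  obtain ⟨w, hw⟩ : ∃ w : Subgroup.center H, w ^ 2 ^ j ≠ 1 := by
    by_contra! h
    have h1 := center_pow_eq_one hH φ h z
    rw [← orderOf_dvd_iff_pow_eq_one, hz, hm] at h1
    exact absurd (Nat.le_of_dvd (by positivity) h1)
      (not_le.2 (Nat.pow_lt_pow_right (by norm_num) (Nat.lt_succ_self j)))
  refine isCyclic_of_orderOf_eq_card w ?_
  rw [← hcard, hm]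
  obtain ⟨t, ht⟩ := IsPGroup.iff_orderOf.1 (hH.to_subgroup (Subgroup.center H)) w
  have h1 : j + 1 ≤ t := by
    by_contra! hlt
    apply hw
    rw [← orderOf_dvd_iff_pow_eq_one, ht]
    exact pow_dvd_pow 2 (by omega)
  have h2 : orderOf w ∣ 2 ^ (j + 1) := hm ▸ hcard ▸ orderOf_dvd_natCard w
  rw [ht] at h2 ⊢
  exact Nat.dvd_antisymm h2 (pow_dvd_pow 2 h1)

end MonoidAlgebra

end Invariants

/-! ### The abelianization and the index of G'Z(G) as invariants -/

namespace MonoidAlgebra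

section Abelianization

variable {F : Type*} [Field F] {G H : Type*} [Group G] [Group H]

/-- The projection of the group algebra to that of the abelianization. -/
noncomputable abbrev abelHom (F G : Type*) [Field F] [Group G] :
    MonoidAlgebra F G →ₐ[F] MonoidAlgebra F (Abelianization G) :=
  mapDomainAlgHom F F Abelianization.of

theorem abelHom_single (g : G) (r : F) :
    abelHom F G (single g r) = single (Abelianization.of g) r := by
  simp [abelHom]

/-- The target is commutative, so the map from G to its units factors through the abelianization. -/
theorem exists_abelianization_algHom (φ : MonoidAlgebra F G →ₐ[F] MonoidAlgebra F H) :
    ∃ θ : MonoidAlgebra F (Abelianization G) →ₐ[F] MonoidAlgebra F (Abelianization H),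
      ∀ x, θ (abelHom F G x) = abelHom F H (φ x) := by
  let ψ : G →* MonoidAlgebra F (Abelianization H) :=
    ((abelHom F H).comp φ : MonoidAlgebra F G →* _).comp (of F G)
  let θ : MonoidAlgebra F (Abelianization G) →ₐ[F] MonoidAlgebra F (Abelianization H) :=
    lift F _ _ ((Units.coeHom _).comp (Abelianization.lift ψ.toHomUnits))
  refine ⟨θ, fun x ↦ ?_⟩
  have : θ.comp (abelHom F G) = (abelHom F H).comp φ := by
    refine algHom_ext' (MonoidHom.ext fun g ↦ ?_) (by ext)
    simp [θ, ψ]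
  exact DFunLike.congr_fun this x

theorem exists_abelianization_algEquiv (φ : MonoidAlgebra F G ≃ₐ[F] MonoidAlgebra F H) :
    ∃ θ : MonoidAlgebra F (Abelianization G) ≃ₐ[F] MonoidAlgebra F (Abelianization H),
      ∀ x, θ (abelHom F G x) = abelHom F H (φ x) := by
  obtain ⟨θ, hθ⟩ := exists_abelianization_algHom (φ : MonoidAlgebra F G →ₐ[F] MonoidAlgebra F H)
  obtain ⟨η, hη⟩ := exists_abelianization_algHom
    (φ.symm : MonoidAlgebra F H →ₐ[F] MonoidAlgebra F G)
  refine ⟨AlgEquiv.ofAlgHom θ η ?_ ?_, hθ⟩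
  · refine algHom_ext' (MonoidHom.ext fun s ↦ ?_) (by ext)
    obtain ⟨g, rfl⟩ := QuotientGroup.mk_surjective s
    change θ (η (single (Abelianization.of g) 1)) = single (Abelianization.of g) 1
    rw [← abelHom_single, hη, hθ]
    simp
  · refine algHom_ext' (MonoidHom.ext fun s ↦ ?_) (by ext)
    obtain ⟨g, rfl⟩ := QuotientGroup.mk_surjective s
    change η (θ (single (Abelianization.of g) 1)) = single (Abelianization.of g) 1
    rw [← abelHom_single, hθ, hη]
    simp

theorem abelianization_pow_eq_one [CharP F 2] (φ : MonoidAlgebra F G ≃ₐ[F] MonoidAlgebra F H)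
    {j : ℕ} (hj : ∀ s : Abelianization G, s ^ 2 ^ j = 1) (s : Abelianization H) :
    s ^ 2 ^ j = 1 := by
  obtain ⟨θ, -⟩ := exists_abelianization_algEquiv φ
  by_contra hne
  have h1 := congrArg θ (pow_eq_algebraMap_of_comm mul_comm hj (θ.symm (single s (1 : F))))
  rw [map_pow, AlgEquiv.apply_symm_apply, AlgEquiv.commutes, single_pow, one_pow] at h1
  have h2 := congrArg (fun t : MonoidAlgebra F (Abelianization H) ↦ t.coeff (s ^ 2 ^ j)) h1
  simp only [coeff_single, Finsupp.single_eq_same, algebraMap_coeff_of_ne_one hne] at h2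
  exact one_ne_zero h2

/-- A noncentral class collapses to one element of the abelianization with even multiplicity, hence
to zero. So central elements of FH have image supported on the image of Z(H), and the induced
isomorphism embeds one group algebra of the image of the center into the other. -/
theorem card_map_center_le [CharP F 2] [Finite G] [Finite H] (hH : IsPGroup 2 H)
    (φ : MonoidAlgebra F G ≃ₐ[F] MonoidAlgebra F H) :
    Nat.card ((Subgroup.center G).map Abelianization.of) ≤
      Nat.card ((Subgroup.center H).map Abelianization.of) := by
  have := Fintype.ofFinite H
  have := Fintype.ofFinite (Subgroup.center H)
  set SG := (Subgroup.center G).map Abelianization.of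
  set SH := (Subgroup.center H).map Abelianization.of
  have := Fintype.ofFinite SG
  have := Fintype.ofFinite SH
  obtain ⟨θ, hθ⟩ := exists_abelianization_algEquiv φ
  let ι : MonoidAlgebra F SG →ₐ[F] MonoidAlgebra F (Abelianization G) :=
    mapDomainAlgHom F F SG.subtype
  have hsupp : ∀ u : MonoidAlgebra F SG, ∀ s ∉ SH, (θ (ι u)).coeff s = 0 := by
    intro u s hs
    induction u using induction_on with
    | of m =>
      obtain ⟨g, hg, hgm⟩ := m.2
      have h1 : ι (of F SG m) = abelHom F G (single g 1) := by
        rw [abelHom_single, hgm]; simp [ι]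
      have h2 : single g (1 : F) = centerHom F G (single ⟨g, hg⟩ 1) := by rw [centerHom_single]
      rw [h1, hθ]
      have h3 : φ (single g 1) ∈ Subalgebra.center F (MonoidAlgebra F H) :=
        φ.map_mem_center (h2 ▸ centerHom_mem_center _)
      have h4 : (abelHom F H).toLinearMap =
          wt fun h ↦ single (Abelianization.of h) (1 : F) := by
        rw [eq_wt (abelHom F H).toLinearMap]
        congr 1
        ext1 h
        exact abelHom_single h 1
      have h5 := wt_of_mem_center hH h3 (h := fun h ↦ single (Abelianization.of h) (1 : F)) (by
        intro g y
        simp)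
      rw [← h4] at h5
      change abelHom F H _ = _ at h5
      rw [h5, coeff_sum, Finsupp.finsetSum_apply]
      refine Finset.sum_eq_zero fun z _ ↦ ?_
      have h6 : Abelianization.of (z : H) ≠ s := by
        rintro rfl
        exact hs ⟨z, z.2, rfl⟩
      rw [coeff_smul, Finsupp.smul_apply, coeff_single, Finsupp.single_eq_of_ne h6.symm, smul_zero]
    | add x y hx hy => rw [map_add, map_add, coeff_add, Finsupp.add_apply, hx, hy, add_zero]
    | smul r x hx => rw [map_smul, map_smul, coeff_smul, Finsupp.smul_apply, hx, smul_zero]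
  let E : MonoidAlgebra F SG →ₗ[F] (SH → F) :=
    LinearMap.pi fun s ↦ Finsupp.lapply (s : Abelianization H) ∘ₗ
      (coeffLinearEquiv F).toLinearMap ∘ₗ θ.toLinearMap ∘ₗ ι.toLinearMap
  have hE : Function.Injective E := by
    rw [← LinearMap.ker_eq_bot, eq_bot_iff]
    intro u hu
    have hu' : ∀ s : SH, (θ (ι u)).coeff s = 0 := fun z ↦ congrFun (LinearMap.mem_ker.1 hu) z
    have h1 : θ (ι u) = 0 := by
      ext s
      by_cases hs : s ∈ SH
      · exact hu' ⟨s, hs⟩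
      · exact hsupp u s hs
    have h2 : ι u = 0 := by simpa using h1
    rw [Submodule.mem_bot]
    ext s
    have h3 : (ι u).coeff (s : Abelianization G) = u.coeff s := by
      simp only [ι, mapDomainAlgHom_apply]
      exact Finsupp.mapDomain_apply Subtype.val_injective _ _
    rw [← h3, h2]; rfl
  have h1 := LinearMap.finrank_le_finrank_of_injective hE
  rw [Module.finrank_fintype_fun_eq_card, (coeffLinearEquiv F).finrank_eq,
    Module.finrank_finsupp_self] at h1
  simpa only [Nat.card_eq_fintype_card] using h1

theorem index_commutator_sup_center_eq (G : Type*) [Group G] :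
    (commutator G ⊔ Subgroup.center G).index =
      ((Subgroup.center G).map (Abelianization.of (G := G))).index := by
  have hs : Function.Surjective (Abelianization.of : G →* _) := QuotientGroup.mk_surjective
  rw [Subgroup.index_map, MonoidHom.range_eq_top.2 hs, Subgroup.index_top, mul_one,
    Abelianization.ker_of, sup_comm]

theorem index_commutator_sup_center_le [CharP F 2] [Finite G] [Finite H] (hH : IsPGroup 2 H)
    (φ : MonoidAlgebra F G ≃ₐ[F] MonoidAlgebra F H) :
    (commutator H ⊔ Subgroup.center H).index ≤ (commutator G ⊔ Subgroup.center G).index := by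
  rw [index_commutator_sup_center_eq, index_commutator_sup_center_eq]
  obtain ⟨θ, -⟩ := exists_abelianization_algEquiv φ
  have h1 := card_map_center_le hH φ
  have h2 := Subgroup.card_mul_index ((Subgroup.center G).map (Abelianization.of (G := G)))
  have h3 := Subgroup.card_mul_index ((Subgroup.center H).map (Abelianization.of (G := H)))
  rw [card_eq θ, ← h3] at h2
  have h4 : 0 < Nat.card ((Subgroup.center G).map (Abelianization.of (G := G))) := Nat.card_pos
  by_contra! hlt
  have h5 := Nat.mul_le_mul_right
    ((Subgroup.center H).map (Abelianization.of (G := H))).index h1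
  nlinarith

end Abelianization

end MonoidAlgebra

/-! ### Point derivations and elements of square zero -/

section SquareZero

/-- `f` is a derivation at the augmentation `ε`. -/
def IsPointDerivation {F B : Type*} [Field F] [Ring B] [Algebra F B] (ε : B →ₐ[F] F)
    (f : B →ₗ[F] F) : Prop :=
  ∀ x y, f (x * y) = ε x * f y + f x * ε y

/-- Only the zero point derivation vanishes on all elements of square zero. -/
def SquareZeroSeparates (F B : Type*) [Field F] [Ring B] [Algebra F B] : Prop :=
  ∀ (ε : B →ₐ[F] F) (f : B →ₗ[F] F), IsPointDerivation ε f →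
    (∀ x, x * x = 0 → f x = 0) → f = 0

/-- Some point derivation does not vanish on some element of square zero. -/
def SquareZeroDetects (F B : Type*) [Field F] [Ring B] [Algebra F B] : Prop :=
  ∃ (ε : B →ₐ[F] F) (f : B →ₗ[F] F) (x : B), IsPointDerivation ε f ∧ x * x = 0 ∧ f x ≠ 0

theorem SquareZeroSeparates.of_algEquiv {F B B' : Type*} [Field F] [Ring B] [Algebra F B]
    [Ring B'] [Algebra F B'] (φ : B ≃ₐ[F] B') (h : SquareZeroSeparates F B) :
    SquareZeroSeparates F B' := by
  intro ε f hf hS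
  have h1 := h (ε.comp φ.toAlgHom) (f ∘ₗ φ.toLinearMap)
    (fun x y ↦ by simpa using hf (φ x) (φ y))
    (fun x hx ↦ hS (φ x) (by rw [← map_mul, hx, map_zero]))
  ext x
  obtain ⟨y, rfl⟩ := φ.surjective x
  exact LinearMap.congr_fun h1 y

theorem SquareZeroDetects.of_algEquiv {F B B' : Type*} [Field F] [Ring B] [Algebra F B]
    [Ring B'] [Algebra F B'] (φ : B ≃ₐ[F] B') (h : SquareZeroDetects F B') :
    SquareZeroDetects F B := by
  obtain ⟨ε, f, x, hf, hx, hfx⟩ := h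
  refine ⟨ε.comp φ.toAlgHom, f ∘ₗ φ.toLinearMap, φ.symm x,
    fun x y ↦ by simpa using hf (φ x) (φ y), by rw [← map_mul, hx, map_zero], by simpa using hfx⟩

namespace MonoidAlgebra

variable {F : Type*} [Field F]

/-- The only root of unity of 2-power order in F is 1, so the augmentation is the only possible ε.
-/
theorem algHom_single_eq_one [CharP F 2] {G : Type*} [Group G] (hG : IsPGroup 2 G)
    (ε : MonoidAlgebra F G →ₐ[F] F) (g : G) : ε (single g 1) = 1 := by
  obtain ⟨n, hn⟩ := hG g
  have h1 : ε (single g 1) ^ 2 ^ n = 1 ^ 2 ^ n := by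
    rw [← map_pow, single_pow, hn, one_pow, ← one_def, map_one]
  exact iterateFrobenius_inj F 2 n h1

/-- The point derivation of a group algebra defined by an additive character. -/
noncomputable def pointDerivation {G : Type*} [Group G] (χ : G →* Multiplicative F) :
    MonoidAlgebra F G →ₗ[F] F :=
  wt fun g ↦ (χ g).toAdd

theorem isPointDerivation_pointDerivation {G : Type*} [Group G] (χ : G →* Multiplicative F) :
    IsPointDerivation (lift F F G 1) (pointDerivation χ) := by
  intro x y
  induction x using induction_on with
  | of g =>
    induction y using induction_on with
    | of h => simp [pointDerivation, single_mul_single, add_comm]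
    | add x y hx hy => rw [mul_add, map_add, hx, hy, map_add, map_add]; ring
    | smul r x hx =>
      rw [mul_smul_comm, map_smul, hx, map_smul, map_smul]; simp only [smul_eq_mul]; ring
  | add x y hx hy => rw [add_mul, map_add, hx, hy, map_add, map_add]; ring
  | smul r x hx =>
    rw [smul_mul_assoc, map_smul, hx, map_smul, map_smul]; simp only [smul_eq_mul]; ring

theorem IsPointDerivation.exists_character [CharP F 2] {G : Type*} [Group G] (hG : IsPGroup 2 G)
    {ε : MonoidAlgebra F G →ₐ[F] F} {f : MonoidAlgebra F G →ₗ[F] F} (hf : IsPointDerivation ε f) :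
    ∃ χ : G →* Multiplicative F, f = pointDerivation χ := by
  have hmul : ∀ g h : G, f (single (g * h) 1) = f (single g 1) + f (single h 1) := by
    intro g h
    have := hf (single g 1) (single h 1)
    rw [algHom_single_eq_one hG, algHom_single_eq_one hG, single_mul_single] at this
    rw [one_mul, mul_one, one_mul] at this
    rw [this, add_comm]
  refine ⟨MonoidHom.mk' (fun g ↦ Multiplicative.ofAdd (f (single g 1))) fun g h ↦ ?_, eq_wt f⟩
  rw [hmul, ofAdd_add]

section Trace

variable {G : Type*} [Group G] [Fintype G] [CharP F 2]

/-- In the coefficient of x² at c, the terms for g and g⁻¹c coincide and cancel in pairs; what is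
left comes from the square roots of c. -/
theorem coeff_mul_self_of_mem_center [DecidableEq G] (x : MonoidAlgebra F G) {c : G}
    (hc : c ∈ Subgroup.center G) :
    (x * x).coeff c = (∑ g, if g ^ 2 = c then x.coeff g else 0) ^ 2 := by
  have hcc : ∀ g, g * c = c * g := Subgroup.mem_center_iff.1 hc
  rw [CharTwo.sum_sq, coeff_mul_apply_left, Finsupp.sum_fintype _ _ (by simp), ← sub_eq_zero,
    ← Finset.sum_sub_distrib]
  have hinv : ∀ g : G, (g⁻¹ * c)⁻¹ * c = g := by
    intro g
    rw [mul_inv_rev, inv_inv, mul_assoc, hcc, inv_mul_cancel_left]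
  have hfix : ∀ g : G, g ^ 2 = c → g⁻¹ * c = g := by
    rintro g rfl; rw [pow_two, inv_mul_cancel_left]
  have hfix' : ∀ g : G, (g⁻¹ * c) ^ 2 = c → g ^ 2 = c := by
    intro g hg
    have h1 := hfix _ hg
    rw [hinv] at h1
    rw [pow_two]; nth_rewrite 2 [h1]; rw [mul_inv_cancel_left]
  refine Finset.sum_involution (fun g _ ↦ g⁻¹ * c) ?_ ?_ (fun _ _ ↦ Finset.mem_univ _)
    (fun g _ ↦ hinv g)
  · intro g _
    by_cases hg : g ^ 2 = c
    · have h2 := hfix g hg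
      simp only [h2, hg, if_true, pow_two, sub_self, add_zero]
    · have hg' : ¬ (g⁻¹ * c) ^ 2 = c := fun h ↦ hg (hfix' g h)
      rw [if_neg hg, if_neg hg', hinv, mul_comm (x.coeff (g⁻¹ * c))]
      simp [CharTwo.add_self_eq_zero]
  · intro g _ hne heq
    apply hne
    have hg : g ^ 2 = c := by
      rw [pow_two]; nth_rewrite 2 [← heq]; rw [mul_inv_cancel_left]
    rw [heq, if_pos hg, pow_two, sub_self]

theorem sum_sq_eq_of_mul_self_eq_zero [DecidableEq G] {x : MonoidAlgebra F G} (hx : x * x = 0)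
    {c : G} (hc : c ∈ Subgroup.center G) : (∑ g, if g ^ 2 = c then x.coeff g else 0) = 0 := by
  have := coeff_mul_self_of_mem_center x hc
  rw [hx] at this
  exact pow_eq_zero_iff (two_ne_zero) |>.1 this.symm

end Trace

section SemilinearSquare

variable {G : Type*} [Group G] (s : G →* ℤˣ)

/-- The inclusion of the group algebra of the kernel of a sign character. -/
noncomputable abbrev kerHom (F : Type*) [Field F] :
    MonoidAlgebra F s.ker →ₐ[F] MonoidAlgebra F G :=
  mapDomainAlgHom F F s.ker.subtype

theorem kerHom_single (z : s.ker) (r : F) : kerHom s F (single z r) = single (z : G) r := by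
  simp [kerHom]

theorem coeff_kerHom (y : MonoidAlgebra F s.ker) (z : s.ker) :
    (kerHom s F y).coeff z = y.coeff z := by
  simp only [kerHom, mapDomainAlgHom_apply]
  exact Finsupp.mapDomain_apply Subtype.val_injective _ _

theorem coeff_kerHom_of_notMem (y : MonoidAlgebra F s.ker) {g : G} (hg : g ∉ s.ker) :
    (kerHom s F y).coeff g = 0 := by
  simp only [kerHom, mapDomainAlgHom_apply]
  exact Finsupp.mapDomain_of_notMem_range _ _ (by simpa using hg)

theorem exists_eq_kerHom_add {b : G} (hb : s b = -1) (x : MonoidAlgebra F G) :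
    ∃ p q, x = kerHom s F p + kerHom s F q * single b 1 := by
  induction x using induction_on with
  | of g =>
    rcases Int.units_eq_one_or (s g) with hg | hg
    · exact ⟨single ⟨g, hg⟩ 1, 0, by simp⟩
    · refine ⟨0, single ⟨g * b⁻¹, by simp [MonoidHom.mem_ker, hg, hb]⟩ 1, ?_⟩
      simp [single_mul_single]
  | add x y hx hy =>
    obtain ⟨p, q, rfl⟩ := hx
    obtain ⟨p', q', rfl⟩ := hy
    refine ⟨p + p', q + q', ?_⟩
    rw [map_add, map_add, add_mul]; abel
  | smul r x hx =>
    obtain ⟨p, q, rfl⟩ := hx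
    refine ⟨r • p, r • q, ?_⟩
    rw [map_smul, map_smul, smul_mul_assoc, smul_add]

/-- Write x = p + qb over the commutative algebra of the kernel, with σ conjugation by b. The b-part
of x² = 0 says q(p + σp) = 0; the nonvanishing weight is the augmentation of q, so some power of q
is a nonzero scalar and p = σp. -/
theorem coeff_conj_eq_of_mul_self_eq_zero [Finite G] [CharP F 2] (hG : IsPGroup 2 G)
    (hs : ∀ x y : s.ker, x * y = y * x) {b : G} (hb : s b = -1) {x : MonoidAlgebra F G}
    (hx : x * x = 0) (hne : wt (fun g ↦ if s g = 1 then (0 : F) else 1) x ≠ 0) {g : G}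
    (hg : s g = 1) : x.coeff (b * g * b⁻¹) = x.coeff g := by
  obtain ⟨p, q, rfl⟩ := exists_eq_kerHom_add s hb x
  let σ : MonoidAlgebra F s.ker →ₐ[F] MonoidAlgebra F s.ker :=
    mapDomainAlgHom F F (MulAut.conjNormal b : MulAut s.ker).toMonoidHom
  have hσ : ∀ y, single b 1 * kerHom s F y = kerHom s F (σ y) * single b 1 := by
    intro y
    induction y using induction_on with
    | of m => simp [σ, single_mul_single]
    | add x y hx hy => simp only [map_add, mul_add, add_mul, hx, hy]
    | smul r x hx => simp only [map_smul, mul_smul_comm, smul_mul_assoc, hx]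
  have hb2 : b ^ 2 ∈ s.ker := by simp [MonoidHom.mem_ker, hb]
  have hbb : (single b 1 * single b 1 : MonoidAlgebra F G) =
      kerHom s F (single ⟨b ^ 2, hb2⟩ 1) := by
    rw [kerHom_single, single_mul_single, one_mul, ← pow_two]
  have hcomm := commute_of_comm (F := F) hs
  have hsq : (kerHom s F p + kerHom s F q * single b 1) *
      (kerHom s F p + kerHom s F q * single b 1) =
      kerHom s F (p * p + q * σ q * single ⟨b ^ 2, hb2⟩ 1) +
        kerHom s F (q * (p + σ p)) * single b 1 := by
    have e1 : kerHom s F q * single b 1 * kerHom s F p =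
        kerHom s F (q * σ p) * single b 1 := by
      rw [mul_assoc, hσ, ← mul_assoc, ← map_mul]
    have e2 : kerHom s F q * single b 1 * (kerHom s F q * single b 1) =
        kerHom s F (q * σ q * single ⟨b ^ 2, hb2⟩ 1) := by
      rw [← mul_assoc, mul_assoc (kerHom s F q), hσ, mul_assoc, mul_assoc, hbb, ← map_mul,
        ← map_mul, mul_assoc]
    rw [add_mul, mul_add, mul_add, e1, e2, ← mul_assoc, ← map_mul, ← map_mul, (hcomm p q).eq,
      mul_add, map_add, map_add, add_mul]
    abel
  rw [hsq] at hx
  have hq0 : q * (p + σ p) = 0 := by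
    ext h
    have h1 := congrArg (fun t : MonoidAlgebra F G ↦ t.coeff (h * b)) hx
    have hhb : (h : G) * b ∉ s.ker := by
      rw [MonoidHom.mem_ker, map_mul, hb, MonoidHom.mem_ker.1 h.2]; decide
    simp only [coeff_add, Finsupp.add_apply, coeff_kerHom_of_notMem s _ hhb, zero_add,
      coeff_mul_single_apply, mul_inv_cancel_right, mul_one, coeff_kerHom] at h1
    exact h1
  have hwt : wt (fun g ↦ if s g = 1 then (0 : F) else 1)
      (kerHom s F p + kerHom s F q * single b 1) = wt (fun _ ↦ (1 : F)) q := by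
    have e1 : (wt (fun g ↦ if s g = 1 then (0 : F) else 1)) ∘ₗ (kerHom s F).toLinearMap = 0 := by
      refine linearMap_ext fun m ↦ ?_
      have := MonoidHom.mem_ker.1 m.2
      simp [this]
    have e2 : (wt (fun g ↦ if s g = 1 then (0 : F) else 1)) ∘ₗ
        LinearMap.mulRight F (single b 1) ∘ₗ (kerHom s F).toLinearMap = wt (fun _ ↦ (1 : F)) := by
      refine linearMap_ext fun m ↦ ?_
      have := MonoidHom.mem_ker.1 m.2
      simp [this, single_mul_single, hb]
    have e3 := LinearMap.congr_fun e1 p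
    have e4 := LinearMap.congr_fun e2 q
    simp only [LinearMap.comp_apply, AlgHom.toLinearMap_apply, LinearMap.mulRight_apply,
      LinearMap.zero_apply] at e3 e4
    rw [map_add, e3, e4, zero_add]
  rw [hwt] at hne
  obtain ⟨j, hj⟩ := IsPGroup.iff_card.1 (hG.to_subgroup s.ker)
  have hexp : ∀ t : s.ker, t ^ 2 ^ j = 1 := fun t ↦ by rw [← hj]; exact pow_card_eq_one'
  have hqp := pow_eq_algebraMap_of_comm hs hexp q
  obtain ⟨n, hn⟩ := Nat.exists_eq_succ_of_ne_zero (pow_ne_zero j (two_ne_zero (α := ℕ)))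
  have h1 : q ^ 2 ^ j * (p + σ p) = 0 := by
    rw [hn, pow_succ, mul_assoc, hq0, mul_zero]
  rw [hqp, ← Algebra.smul_def, smul_eq_zero, or_iff_right (pow_ne_zero _ hne)] at h1
  have h2 : p = σ p := by
    rw [← sub_eq_zero, CharTwo.sub_eq_add]; exact h1
  have hbg : b * g * b⁻¹ ∈ s.ker := by simp [MonoidHom.mem_ker, hg]
  have hgb : ∀ h : G, s h = 1 → h * b⁻¹ ∉ s.ker := by
    intro h hh
    rw [MonoidHom.mem_ker, map_mul, map_inv, hb, hh]; decide
  have key : ∀ h : s.ker, (kerHom s F p + kerHom s F q * single b 1).coeff h = p.coeff h := by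
    intro h
    simp only [coeff_add, Finsupp.add_apply, coeff_mul_single_apply, mul_one,
      coeff_kerHom_of_notMem s _ (hgb h h.2), add_zero, coeff_kerHom]
  rw [key ⟨_, hbg⟩, key ⟨g, hg⟩]
  have h3 : (σ p).coeff (MulAut.conjNormal b (⟨g, hg⟩ : s.ker)) = p.coeff ⟨g, hg⟩ := by
    simp only [σ, mapDomainAlgHom_apply]
    exact Finsupp.mapDomain_apply (MulAut.conjNormal b : MulAut s.ker).injective _ _
  rw [← h3, ← h2]
  congr 1

end SemilinearSquare

end MonoidAlgebra

end SquareZero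

/-! ### Square-zero elements for the dihedral group of order eight -/

section DihedralEight

open DihedralGroup

theorem univ_dihedralGroup_four : (Finset.univ : Finset (DihedralGroup 4)) =
    {r 0, r 1, r 2, r 3, sr 0, sr 1, sr 2, sr 3} := by decide

theorem sum_dihedralGroup_four {M : Type*} [AddCommMonoid M] (h : DihedralGroup 4 → M) :
    ∑ d, h d = h (r 0) + (h (r 1) + (h (r 2) + (h (r 3) + (h (sr 0) + (h (sr 1) +
      (h (sr 2) + h (sr 3))))))) := by
  rw [univ_dihedralGroup_four]
  repeat rw [Finset.sum_insert (by decide)]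
  rw [Finset.sum_singleton]

namespace MonoidAlgebra

variable {F : Type*} [Field F] [CharP F 2]

/-- The linear equation is the trace identity at the central rotation; the product is the
coefficient of the square at the rotation `r 1`, where the terms from rotations occur twice. -/
theorem dihedralGroup_four_of_mul_self_eq_zero {y : MonoidAlgebra F (DihedralGroup 4)}
    (hy : y * y = 0) : y.coeff (r 1) + y.coeff (r 3) = 0 ∧
      (y.coeff (sr 0) + y.coeff (sr 2)) * (y.coeff (sr 1) + y.coeff (sr 3)) = 0 := by
  constructor
  · have h1 := sum_sq_eq_of_mul_self_eq_zero hy (c := r 2)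
      (Subgroup.mem_center_iff.2 (by decide))
    rw [sum_dihedralGroup_four, if_neg (by decide), if_pos (by decide), if_neg (by decide),
      if_pos (by decide), if_neg (by decide), if_neg (by decide), if_neg (by decide),
      if_neg (by decide)] at h1
    simpa using h1
  · have h1 : (y * y).coeff (r 1) = 0 := by rw [hy]; rfl
    rw [coeff_mul_apply_left, Finsupp.sum_fintype _ _ (by simp), sum_dihedralGroup_four] at h1
    rw [show (r 0 : DihedralGroup 4)⁻¹ * r 1 = r 1 by decide,
      show (r 1 : DihedralGroup 4)⁻¹ * r 1 = r 0 by decide,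
      show (r 2 : DihedralGroup 4)⁻¹ * r 1 = r 3 by decide,
      show (r 3 : DihedralGroup 4)⁻¹ * r 1 = r 2 by decide,
      show (sr 0 : DihedralGroup 4)⁻¹ * r 1 = sr 1 by decide,
      show (sr 1 : DihedralGroup 4)⁻¹ * r 1 = sr 2 by decide,
      show (sr 2 : DihedralGroup 4)⁻¹ * r 1 = sr 3 by decide,
      show (sr 3 : DihedralGroup 4)⁻¹ * r 1 = sr 0 by decide] at h1
    linear_combination h1 - (y.coeff (r 0) * y.coeff (r 1) + y.coeff (r 2) * y.coeff (r 3)) *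
      CharTwo.two_eq_zero (R := F)

end MonoidAlgebra

end DihedralEight

/-! ### Homomorphisms from the family, and square-zero elements when b² = z -/

section Types

open MonoidAlgebra DihedralGroup

namespace IsDihedralExt

variable {G : Type*} [Group G] {k l e f : ℕ} {a b z : G}
variable {F : Type*} [Field F]

theorem exists_sign [Finite G] (h : IsDihedralExt k l e f a b z) :
    ∃ s : G →* ℤˣ, s a = -1 ∧ s b = -1 ∧ s z = 1 :=
  h.exists_lift (by simp) (by simp) (by simp)

theorem exists_character [CharP F 2] [Finite G] (h : IsDihedralExt k l e f a b z) (α β : F) :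
    ∃ χ : G →* Multiplicative F, χ a = .ofAdd α ∧ χ b = .ofAdd β ∧ χ z = 1 := by
  have h2 : ∀ γ : F, (Multiplicative.ofAdd γ) ^ 2 = 1 := by
    intro γ
    rw [← ofAdd_nsmul, two_nsmul, CharTwo.add_self_eq_zero, ofAdd_zero]
  refine h.exists_lift (h2 α) (h2 β) ?_
  rw [pow_succ', pow_mul, ← ofAdd_add, h2, one_pow]

theorem exists_hom_dihedralGroup_four [Finite G] (h : IsDihedralExt (k + 1) l e f a b z) :
    ∃ π : G →* DihedralGroup 4, π a = sr 0 ∧ π b = sr 1 ∧ π z = 1 :=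
  h.exists_lift (by decide) (by decide) (by
    rw [pow_add, pow_add, pow_one, mul_assoc, mul_comm, pow_mul,
      show ((sr 0 * sr 1 : DihedralGroup 4)) ^ (2 * 2) = 1 by decide, one_pow])

theorem hom_ext (h : IsDihedralExt k l e f a b z) {K : Type*} [Group K] {φ ψ : G →* K}
    (ha : φ a = ψ a) (hb : φ b = ψ b) (hz : φ z = ψ z) : φ = ψ :=
  MonoidHom.eq_of_eqOn_dense h.closure_eq_top (by rintro x (rfl | rfl | rfl) <;> assumption)

theorem exists_zpow_of_sign_eq_one (h : IsDihedralExt k l e f a b z) {s : G →* ℤˣ}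
    (ha : s a = -1) (hb : s b = -1) (hz : s z = 1) {g : G} (hg : s g = 1) :
    ∃ i j : ℤ, g = (a * b) ^ i * z ^ j := by
  obtain ⟨i, j, hij | rfl⟩ := h.exists_zpow_form g
  · exact ⟨i, j, hij⟩
  · simp [ha, hb, hz] at hg

theorem exists_zpow_of_sign_ne_one (h : IsDihedralExt k l e f a b z) {s : G →* ℤˣ}
    (ha : s a = -1) (hb : s b = -1) (hz : s z = 1) {g : G} (hg : s g ≠ 1) :
    ∃ i j : ℤ, g = (a * b) ^ i * z ^ j * a := by
  obtain ⟨i, j, rfl | hij⟩ := h.exists_zpow_form g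
  · simp [ha, hb, hz] at hg
  · exact ⟨i, j, hij⟩

theorem comm_of_sign_eq_one (h : IsDihedralExt k l e f a b z) {s : G →* ℤˣ}
    (ha : s a = -1) (hb : s b = -1) (hz : s z = 1) (x y : s.ker) : x * y = y * x := by
  obtain ⟨i, j, hx⟩ := h.exists_zpow_of_sign_eq_one ha hb hz x.2
  obtain ⟨i', j', hy⟩ := h.exists_zpow_of_sign_eq_one ha hb hz y.2
  refine Subtype.ext ?_
  rw [Subgroup.coe_mul, Subgroup.coe_mul, hx, hy]
  have h1 : Commute (z ^ j) ((a * b) ^ i') := (h.comm_ab.zpow_left j).zpow_right i'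
  have h2 : Commute (z ^ j') ((a * b) ^ i) := (h.comm_ab.zpow_left j').zpow_right i
  exact ((((Commute.refl _).zpow_zpow i i').mul_left h1).mul_right
    ((h2.symm).mul_left ((Commute.refl z).zpow_zpow j j'))).eq

/-- If `b ^ 2 = z`, an element of square zero whose coefficient sum off the abelian subgroup of
index two does not vanish has vanishing coefficient sum over the elements off that subgroup
whose squares generate the center. -/
theorem wt_eq_zero_of_mul_self_eq_zero [CharP F 2] [Finite G] (h : IsDihedralExt k l e 1 a b z) {s : G →* ℤˣ}
    (ha : s a = -1) (hb : s b = -1) (hz : s z = 1) {x : MonoidAlgebra F G} (hx : x * x = 0)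
    (hne : wt (fun g ↦ if s g = 1 then (0 : F) else 1) x ≠ 0) {u : G → F}
    (hu : ∀ i j : ℤ, u ((a * b) ^ i * z ^ j) = 0)
    (hu1 : ∀ i j q : ℤ, 2 * j + ((e + 1 : ℕ) : ℤ) * i + e = 2 * q + 1 →
      u ((a * b) ^ i * z ^ j * a) = 1)
    (hu0 : ∀ i j q : ℤ, 2 * j + ((e + 1 : ℕ) : ℤ) * i + e = 2 * q →
      u ((a * b) ^ i * z ^ j * a) = 0) :
    wt u x = 0 := by
  classical
  have := Fintype.ofFinite G
  have hG : IsPGroup 2 G := IsPGroup.of_card (n := k + l + 3) (by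
    rw [h.card_eq]; ring)
  have hzc : ∀ q : ℤ, z ^ q ∈ Subgroup.center G := fun q ↦ h.center_eq ▸ ⟨q, rfl⟩
  have hb2 : b ^ 2 = z := by simpa using h.b_sq
  let C : Finset G := Finset.univ.filter fun c ↦ ∃ q : ℤ, c = z ^ (2 * q + 1)
  have hC : ∀ {c}, c ∈ C ↔ ∃ q : ℤ, c = z ^ (2 * q + 1) := by simp [C]
  -- C is the set of odd powers of z; summing the trace identity over C controls all elements whose
  -- square generates the center.
  have h1 : ∑ g : G, (if g ^ 2 ∈ C then x.coeff g else 0) = 0 := by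
    have : ∑ c ∈ C, ∑ g : G, (if g ^ 2 = c then x.coeff g else 0) = 0 := by
      refine Finset.sum_eq_zero fun c hc ↦ ?_
      obtain ⟨q, rfl⟩ := hC.1 hc
      exact sum_sq_eq_of_mul_self_eq_zero hx (hzc _)
    rw [Finset.sum_comm] at this
    simpa using this
  have hconj : ∀ g, s g = 1 → x.coeff (b * g * b⁻¹) = x.coeff g := fun g hg ↦
    coeff_conj_eq_of_mul_self_eq_zero s hG (h.comm_of_sign_eq_one ha hb hz) hb hx hne hg
  -- Inside the kernel of s, coefficients are invariant under conjugation by b, which is an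
  -- involution as b² = z is central. A fixed point would be central, a power of z, whose square is
  -- an even power of z; so the terms cancel in pairs.
  have h2 : ∑ g ∈ Finset.univ.filter (fun g : G ↦ s g = 1 ∧ g ^ 2 ∈ C), x.coeff g = 0 := by
    have hsq : ∀ g : G, g ^ 2 ∈ C → (b * g * b⁻¹) ^ 2 = g ^ 2 := by
      intro g hg
      obtain ⟨q, hq⟩ := hC.1 hg
      rw [conj_pow, hq, Subgroup.mem_center_iff.1 (hzc _) b, mul_inv_cancel_right]
    refine Finset.sum_involution (fun g _ ↦ b * g * b⁻¹) ?_ ?_ ?_ ?_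
    · intro g hg
      rw [hconj g (Finset.mem_filter.1 hg).2.1, CharTwo.add_self_eq_zero]
    · intro g hg _ heq
      obtain ⟨-, hsg, hgC⟩ := Finset.mem_filter.1 hg
      have hgb : Commute g b := (mul_inv_eq_iff_eq_mul.1 heq).symm
      have hgab : Commute g (a * b) := by
        have := h.comm_of_sign_eq_one ha hb hz ⟨g, hsg⟩ ⟨a * b, by simp [MonoidHom.mem_ker, ha, hb]⟩
        exact congrArg Subtype.val this
      have hga : Commute g a := by
        have := hgab.mul_right hgb.inv_right
        rwa [mul_inv_cancel_right] at this
      have hgc := h.mem_center_of_commute hga hgb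
      rw [h.center_eq] at hgc
      obtain ⟨j, rfl⟩ := hgc
      obtain ⟨q, hq⟩ := hC.1 hgC
      change (z ^ j) ^ 2 = _ at hq
      rw [← zpow_natCast, ← zpow_mul, mul_comm] at hq
      exact h.zpow_odd_ne_zpow_even q j hq.symm
    · intro g hg
      obtain ⟨-, hsg, hgC⟩ := Finset.mem_filter.1 hg
      refine Finset.mem_filter.2 ⟨Finset.mem_univ _, by simp [hsg], ?_⟩
      rwa [hsq g hgC]
    · intro g _
      have : b * (b * g * b⁻¹) * b⁻¹ = b ^ 2 * g * (b ^ 2)⁻¹ := by rw [pow_two]; group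
      rw [this, hb2]
      have := Subgroup.mem_center_iff.1 (hzc 1) g
      rw [zpow_one] at this
      rw [← this, mul_inv_cancel_right]
  rw [wt_apply]
  have h3 : ∀ g : G, x.coeff g • u g = (if g ^ 2 ∈ C then x.coeff g else 0) -
      if s g = 1 ∧ g ^ 2 ∈ C then x.coeff g else 0 := by
    intro g
    by_cases hg : s g = 1
    · obtain ⟨i, j, rfl⟩ := h.exists_zpow_of_sign_eq_one ha hb hz hg
      rw [hu]; simp [hg]
    · obtain ⟨i, j, rfl⟩ := h.exists_zpow_of_sign_ne_one ha hb hz hg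
      rw [if_neg (c := _ ∧ _) (fun t ↦ hg t.1), sub_zero]
      rcases Int.even_or_odd' (2 * j + ((e + 1 : ℕ) : ℤ) * i + e) with ⟨q, hq | hq⟩
      · rw [hu0 i j q hq, if_neg, smul_zero]
        rw [hC, h.sq_eq, hq]
        rintro ⟨q', hq'⟩
        exact h.zpow_odd_ne_zpow_even q' q hq'.symm
      · rw [hu1 i j q hq, if_pos, smul_eq_mul, mul_one]
        rw [hC, h.sq_eq, hq]
        exact ⟨q, rfl⟩
  rw [Finset.sum_congr rfl fun g _ ↦ h3 g, Finset.sum_sub_distrib, h1, ← Finset.sum_filter, h2,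
    sub_zero]

end IsDihedralExt

end Types

/-! ### Separating the types by square-zero elements -/

section Distinguish

open MonoidAlgebra DihedralGroup

theorem dihedralExtRel_dihedralGroup_four :
    DihedralExtRel 4 1 0 0 0 (sr 0 : DihedralGroup 4) (sr 1) 1 :=
  ⟨Commute.one_left _, Commute.one_left _, one_pow _, by decide, by decide, by decide⟩

theorem closure_dihedralGroup_four :
    Subgroup.closure {(sr 0 : DihedralGroup 4), sr 1, 1} = ⊤ := by
  set K := Subgroup.closure {(sr 0 : DihedralGroup 4), sr 1, 1}
  have h0 : sr 0 ∈ K := Subgroup.subset_closure (by simp)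
  have h1 : sr 1 ∈ K := Subgroup.subset_closure (by simp)
  have hr : ∀ i : ℕ, r (i : ZMod 4) ∈ K := by
    intro i
    rw [← r_one_pow, show (r 1 : DihedralGroup 4) = sr 0 * sr 1 by decide]
    exact pow_mem (mul_mem h0 h1) i
  rw [eq_top_iff]
  intro d _
  rcases d with i | i
  · have := hr i.val
    rwa [ZMod.natCast_zmod_val] at this
  · have := mul_mem h0 (hr i.val)
    rwa [ZMod.natCast_zmod_val, sr_mul_r, zero_add] at this

namespace IsDihedralExt

variable {G : Type*} [Group G] {k l e f : ℕ} {a b z : G}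
variable {F : Type*} [Field F]

theorem isPGroup [Finite G] (h : IsDihedralExt k l e f a b z) : IsPGroup 2 G :=
  IsPGroup.of_card (n := k + l + 3) (by rw [h.card_eq]; ring)

theorem card_center (h : IsDihedralExt k l e f a b z) :
    Nat.card (Subgroup.center G) = 2 ^ (l + 1) := by
  rw [h.center_eq, Nat.card_zpowers, h.orderOf_eq]

theorem pointDerivation_eq_wt [CharP F 2] (h : IsDihedralExt k l e f a b z) {s : G →* ℤˣ}
    (ha : s a = -1) (hb : s b = -1) (hz : s z = 1) {χ : G →* Multiplicative F}
    (ha' : χ a = .ofAdd 1) (hb' : χ b = .ofAdd 1) (hz' : χ z = 1) :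
    pointDerivation χ = wt (fun g ↦ if s g = 1 then (0 : F) else 1) := by
  have hab : χ (a * b) = 1 := by
    rw [map_mul, ha', hb', ← ofAdd_add, CharTwo.add_self_eq_zero, ofAdd_zero]
  unfold pointDerivation
  congr 1
  ext g
  obtain ⟨i, j, rfl | rfl⟩ := h.exists_zpow_form g
  · rw [if_pos (by simp [ha, hb, hz])]
    simp [map_mul χ _ (z ^ j), hab, hz']
  · rw [if_neg (by simp [ha, hb, hz])]
    simp [map_mul χ _ a, map_mul χ _ (z ^ j), hab, hz', ha']

/-- The values of point derivations at an element of square zero, if the central quotient has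
order at least eight. -/
theorem exists_pointDerivation_eq [CharP F 2] [Finite G] (h : IsDihedralExt (k + 1) l e f a b z)
    {x : MonoidAlgebra F G} (hx : x * x = 0) : ∃ A B : F, A * B = 0 ∧
      (∀ (α β : F) (χ : G →* Multiplicative F), χ a = .ofAdd α → χ b = .ofAdd β → χ z = 1 →
        pointDerivation χ x = A * α + B * β) ∧
      ∀ u : G → F, (∀ i j : ℤ, u ((a * b) ^ i * z ^ j) = 0) →
        (∀ i j : ℤ, u ((a * b) ^ (2 * i) * z ^ j * a) = 0) →
        (∀ i j : ℤ, u ((a * b) ^ (2 * i + 1) * z ^ j * a) = 1) → wt u x = B := by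
  obtain ⟨π, ha, hb, hz⟩ := h.exists_hom_dihedralGroup_four
  set y := mapDomainAlgHom F F π x with hy
  have hyy : y * y = 0 := by rw [hy, ← map_mul, hx, map_zero]
  obtain ⟨h1, h2⟩ := dihedralGroup_four_of_mul_self_eq_zero hyy
  have hpush : ∀ v : DihedralGroup 4 → F, wt (fun g ↦ v (π g)) x = wt v y := by
    intro v
    have : wt (fun g ↦ v (π g)) = wt v ∘ₗ (mapDomainAlgHom F F π).toLinearMap :=
      linearMap_ext fun g ↦ by simp
    rw [this]; rfl
  -- A and B are the coefficient sums of the image of x over the two classes of reflections, {`sr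
  -- 0`, `sr 2`} and {`sr 1`, `sr 3`}; the rotations drop out by `h1`.
  refine ⟨_, _, h2, ?_, ?_⟩
  · intro α β χ ha' hb' hz'
    have hsq : ∀ γ : F, (Multiplicative.ofAdd γ) ^ 2 = 1 := by
      intro γ
      rw [← ofAdd_nsmul, two_nsmul, CharTwo.add_self_eq_zero, ofAdd_zero]
    obtain ⟨ψ, hψa, hψb, -⟩ := dihedralExtRel_dihedralGroup_four.exists_hom (K := Multiplicative F)
      (a := .ofAdd α) (b := .ofAdd β) (z := 1) (by norm_num) (by norm_num)
      closure_dihedralGroup_four DihedralGroup.nat_card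
      ⟨Commute.one_left _, Commute.one_left _, one_pow _, by simpa using hsq α,
        by simpa using hsq β, by
          rw [pow_zero, ← ofAdd_add, show 4 = 2 * 2 from rfl, pow_mul, hsq, one_pow]⟩
    have hχ : χ = ψ.comp π := h.hom_ext (by simp [ha, ha', hψa]) (by simp [hb, hb', hψb])
      (by simp [hz, hz'])
    have hc : ψ (r 1) = .ofAdd (α + β) := by
      rw [show (r 1 : DihedralGroup 4) = sr 0 * sr 1 by decide, map_mul, hψa, hψb, ofAdd_add]
    have hc2 : ψ (r 2) = 1 := by
      rw [show (r 2 : DihedralGroup 4) = r 1 ^ 2 by decide, map_pow, hc, hsq]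
    have hc3 : ψ (r 3) = .ofAdd (α + β) := by
      rw [show (r 3 : DihedralGroup 4) = r 2 * r 1 by decide, map_mul, hc2, hc, one_mul]
    have hs2 : ψ (sr 2) = .ofAdd α := by
      rw [show (sr 2 : DihedralGroup 4) = r 2 * sr 0 by decide, map_mul, hc2, hψa, one_mul]
    have hs3 : ψ (sr 3) = .ofAdd β := by
      rw [show (sr 3 : DihedralGroup 4) = r 2 * sr 1 by decide, map_mul, hc2, hψb, one_mul]
    have hr0 : ψ (r 0) = 1 := map_one ψ
    rw [hχ, pointDerivation]
    simp only [MonoidHom.comp_apply]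
    rw [hpush fun d ↦ (ψ d).toAdd, wt_apply, sum_dihedralGroup_four, hr0, hc, hc2, hc3, hs2, hs3,
      hψa, hψb]
    simp only [toAdd_one, toAdd_ofAdd, smul_eq_mul]
    linear_combination (α + β) * h1
  · intro u hu hu0 hu1
    have hab : π (a * b) = r 1 := by rw [map_mul, ha, hb]; decide
    let v : DihedralGroup 4 → F := fun d ↦ if d = sr 1 ∨ d = sr 3 then 1 else 0
    have huv : u = fun g ↦ v (π g) := by
      ext g
      obtain ⟨i, j, rfl | rfl⟩ := h.exists_zpow_form g
      · rw [hu, map_mul, map_zpow, map_zpow, hab, hz, r_one_zpow, one_zpow, mul_one]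
        simp [v]
      · rw [map_mul, map_mul, map_zpow, map_zpow, hab, hz, one_zpow, mul_one, ha]
        rcases Int.even_or_odd' i with ⟨q, rfl | rfl⟩
        · rw [hu0, zpow_mul]
          rcases Int.even_or_odd' q with ⟨p, rfl | rfl⟩
          · rw [zpow_mul, show ((r 1 : DihedralGroup 4) ^ (2 : ℤ)) ^ (2 : ℤ) = 1 by decide,
              one_zpow, one_mul]
            exact (if_neg (by decide)).symm
          · rw [zpow_add, zpow_mul, show ((r 1 : DihedralGroup 4) ^ (2 : ℤ)) ^ (2 : ℤ) = 1 by decide,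
              one_zpow, one_mul]
            exact (if_neg (by decide)).symm
        · rw [hu1, zpow_add, zpow_mul]
          rcases Int.even_or_odd' q with ⟨p, rfl | rfl⟩
          · rw [zpow_mul, show ((r 1 : DihedralGroup 4) ^ (2 : ℤ)) ^ (2 : ℤ) = 1 by decide,
              one_zpow, one_mul]
            exact (if_pos (by decide)).symm
          · rw [zpow_add, zpow_mul, show ((r 1 : DihedralGroup 4) ^ (2 : ℤ)) ^ (2 : ℤ) = 1 by decide,
              one_zpow, one_mul]
            exact (if_pos (by decide)).symm
    rw [huv, hpush, wt_apply, sum_dihedralGroup_four]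
    simp only [v]
    rw [if_neg (by decide), if_neg (by decide), if_neg (by decide), if_neg (by decide),
      if_neg (by decide), if_pos (by decide), if_neg (by decide), if_pos (by decide)]
    simp

theorem pointDerivation_single_sub_one (χ : G →* Multiplicative F) (g : G) :
    pointDerivation χ (single g 1 - 1) = (χ g).toAdd := by
  rw [map_sub, MonoidAlgebra.one_def]
  simp [pointDerivation]

theorem single_sub_one_mul_self [CharP F 2] {g : G} (hg : g ^ 2 = 1) :
    (single g 1 - 1 : MonoidAlgebra F G) * (single g 1 - 1) = 0 := by
  have h1 : (single g 1 : MonoidAlgebra F G) * single g 1 = 1 := by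
    rw [single_mul_single, ← pow_two, hg, one_mul, MonoidAlgebra.one_def]
  have h2 : (single g 1 - 1 : MonoidAlgebra F G) * (single g 1 - 1) =
      single g 1 * single g 1 - 1 - ((single g 1 - 1) + (single g 1 - 1)) := by noncomm_ring
  rw [h2, h1, sub_self, CharTwo.add_self_eq_zero, sub_zero]

/-- For l = 0 the relation reads (ab)^(2^(k+1)) = z, so the involutions a and b generate G, and the
square-zero elements a - 1 and b - 1 detect every character. -/
theorem squareZeroSeparates [CharP F 2] [Finite G] (h : IsDihedralExt k 0 0 0 a b z) :
    SquareZeroSeparates F (MonoidAlgebra F G) := by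
  intro ε f hf hS
  obtain ⟨χ, rfl⟩ := hf.exists_character h.isPGroup
  have ha : χ a = 1 := by
    have := hS _ (single_sub_one_mul_self (F := F) (by simpa using h.a_sq))
    rwa [pointDerivation_single_sub_one, toAdd_eq_zero] at this
  have hb : χ b = 1 := by
    have := hS _ (single_sub_one_mul_self (F := F) (by simpa using h.b_sq))
    rwa [pointDerivation_single_sub_one, toAdd_eq_zero] at this
  have hz : χ z = 1 := by
    have := congrArg χ h.ab_pow
    rw [map_pow, map_mul, ha, hb] at this
    simpa using this.symm
  have hχ : χ = 1 := h.hom_ext (by simpa using ha) (by simpa using hb) (by simpa using hz)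
  rw [hχ]
  exact linearMap_ext fun g ↦ by simp [pointDerivation]

theorem squareZeroDetects [CharP F 2] [Finite G] (h : IsDihedralExt k l 0 f a b z) :
    SquareZeroDetects F (MonoidAlgebra F G) := by
  obtain ⟨χ, ha, -, -⟩ := h.exists_character (1 : F) 0
  refine ⟨_, _, single a 1 - 1, isPointDerivation_pointDerivation χ,
    single_sub_one_mul_self (by simpa using h.a_sq), ?_⟩
  rw [pointDerivation_single_sub_one, ha]
  simp

/-- When e = f = 1, every element outside the kernel of s squares to an odd power of z. The two
weights of `wt_eq_zero_of_mul_self_eq_zero` coincide, so a nonzero value would force itself to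
vanish. -/
theorem wt_sign_eq_zero [CharP F 2] [Finite G] (h : IsDihedralExt k l 1 1 a b z) {s : G →* ℤˣ}
    (ha : s a = -1) (hb : s b = -1) (hz : s z = 1) {x : MonoidAlgebra F G} (hx : x * x = 0) :
    wt (fun g ↦ if s g = 1 then (0 : F) else 1) x = 0 := by
  by_contra hne
  refine hne (h.wt_eq_zero_of_mul_self_eq_zero ha hb hz hx hne ?_ ?_ ?_)
  · intro i j; simp [ha, hb, hz]
  · intro i j q _; simp [ha, hb, hz]
  · intro i j q hq; push_cast at hq; omega

theorem not_squareZeroSeparates [CharP F 2] [Finite G] (h : IsDihedralExt k l 1 1 a b z) :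
    ¬ SquareZeroSeparates F (MonoidAlgebra F G) := by
  intro hS
  obtain ⟨s, ha, hb, hz⟩ := h.exists_sign
  obtain ⟨χ, ha', hb', hz'⟩ := h.exists_character (1 : F) 1
  have h1 := hS _ _ (isPointDerivation_pointDerivation χ) fun x hx ↦ by
    rw [h.pointDerivation_eq_wt ha hb hz ha' hb' hz', h.wt_sign_eq_zero ha hb hz hx]
  have h2 := pointDerivation_single_sub_one χ a
  rw [h1, ha'] at h2
  simp at h2

/-- The derivation taking the value 1 at a and b kills x, so A + B = 0; with AB = 0 this gives A = B
= 0, and every derivation vanishes at x. -/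
theorem not_squareZeroDetects [CharP F 2] [Finite G] (h : IsDihedralExt (k + 1) l 1 1 a b z) :
    ¬ SquareZeroDetects F (MonoidAlgebra F G) := by
  rintro ⟨ε, f, x, hf, hx, hfx⟩
  apply hfx
  obtain ⟨χ, rfl⟩ := hf.exists_character h.isPGroup
  obtain ⟨s, ha, hb, hz⟩ := h.exists_sign
  obtain ⟨χ', ha', hb', hz'⟩ := h.exists_character (1 : F) 1
  have h1 := h.wt_sign_eq_zero ha hb hz hx
  rw [← h.pointDerivation_eq_wt ha hb hz ha' hb' hz'] at h1
  obtain ⟨A, B, hAB, hval, -⟩ := h.exists_pointDerivation_eq hx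
  rw [hval 1 1 χ' ha' hb' hz', mul_one, mul_one] at h1
  have hz1 : χ z = 1 := by
    have := congrArg χ h.a_sq
    rw [map_pow, pow_one] at this
    rw [← this, ← toAdd_eq_zero, toAdd_pow, two_nsmul, CharTwo.add_self_eq_zero]
  have hBA : B = A := by
    rw [← sub_eq_zero, CharTwo.sub_eq_add, add_comm]; exact h1
  rw [hBA, mul_self_eq_zero] at hAB
  rw [hval (χ a).toAdd (χ b).toAdd χ rfl rfl hz1, hBA, hAB, zero_mul, zero_mul, add_zero]

/-- The derivation trivial at a and nontrivial at b has value B at x. If A + B = 0, then AB = 0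
gives B = 0. Otherwise B is the sum over the elements outside the kernel of s whose squares generate
the center, and this vanishes because b² = z. -/
theorem not_squareZeroSeparates_of_sq_eq_one [CharP F 2] [Finite G]
    (h : IsDihedralExt (k + 1) l 0 1 a b z) : ¬ SquareZeroSeparates F (MonoidAlgebra F G) := by
  intro hS
  obtain ⟨s, ha, hb, hz⟩ := h.exists_sign
  obtain ⟨χ, ha1, hb1, hz1⟩ := h.exists_character (1 : F) 1
  obtain ⟨χ', ha', hb', hz'⟩ := h.exists_character (0 : F) 1
  have h1 := hS _ _ (isPointDerivation_pointDerivation χ') fun x hx ↦ by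
    obtain ⟨A, B, hAB, hval, hvalu⟩ := h.exists_pointDerivation_eq hx
    rw [hval 0 1 χ' ha' hb' hz', mul_zero, zero_add, mul_one]
    by_cases hne : wt (fun g ↦ if s g = 1 then (0 : F) else 1) x = 0
    · rw [← h.pointDerivation_eq_wt ha hb hz ha1 hb1 hz1, hval 1 1 χ ha1 hb1 hz1, mul_one,
        mul_one] at hne
      have hBA : A = B := by
        rw [← sub_eq_zero, CharTwo.sub_eq_add]; exact hne
      rw [hBA, mul_self_eq_zero] at hAB
      exact hAB
    · let u : G → F := fun g ↦ if s g = 1 then 0 else (χ' g).toAdd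
      have hc : χ' (a * b) = .ofAdd 1 := by rw [map_mul, ha', hb', ← ofAdd_add, zero_add]
      have hc2 : χ' (a * b) ^ (2 : ℤ) = 1 := by
        rw [hc, ← ofAdd_zsmul, two_zsmul, CharTwo.add_self_eq_zero, ofAdd_zero]
      have hu : ∀ i j : ℤ, u ((a * b) ^ i * z ^ j) = 0 := by
        intro i j; simp [u, ha, hb, hz]
      have hval' : ∀ i j : ℤ, u ((a * b) ^ i * z ^ j * a) = (χ' (a * b) ^ i).toAdd := by
        intro i j
        simp only [u]
        rw [if_neg (by simp [ha, hb, hz]), map_mul χ' _ a, map_mul χ' _ (z ^ j), map_zpow χ',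
          map_zpow χ', hz', one_zpow, mul_one, ha', ofAdd_zero, mul_one]
      have hu0 : ∀ i j : ℤ, u ((a * b) ^ (2 * i) * z ^ j * a) = 0 := by
        intro i j
        rw [hval', zpow_mul, hc2, one_zpow, toAdd_one]
      have hu1 : ∀ i j : ℤ, u ((a * b) ^ (2 * i + 1) * z ^ j * a) = 1 := by
        intro i j
        rw [hval', zpow_add, zpow_mul, hc2, one_zpow, one_mul, zpow_one, hc, toAdd_ofAdd]
      rw [← hvalu u hu hu0 hu1]
      refine h.wt_eq_zero_of_mul_self_eq_zero ha hb hz hx hne hu ?_ ?_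
      · intro i j q hq
        rcases Int.even_or_odd' i with ⟨p, rfl | rfl⟩
        · exfalso; push_cast at hq; omega
        · exact hu1 p j
      · intro i j q hq
        rcases Int.even_or_odd' i with ⟨p, rfl | rfl⟩
        · exact hu0 p j
        · exfalso; push_cast at hq; omega
  have h2 := pointDerivation_single_sub_one χ' b
  rw [h1, hb'] at h2
  simp at h2

end IsDihedralExt

end Distinguish

/-! ### Separating the types by the exponent of the abelianization -/

section Exponent

namespace IsDihedralExt

variable {G : Type*} [Group G] {k l e f : ℕ} {a b z : G}

/-- Since e = f = 0, (ab)^(2^(k+1)) is z^(2^(l+1)) with l+1 in the role of l; in the abelianization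
the left side is trivial. The bound on the orders of a and b is immediate. -/
theorem abelianization_pow_eq_one (h : IsDihedralExt k (l + 1) 0 0 a b z) (s : Abelianization G) :
    s ^ 2 ^ (l + 1) = 1 := by
  obtain ⟨g, rfl⟩ := QuotientGroup.mk_surjective s
  change (Abelianization.of g) ^ _ = 1
  have ha : a ^ 2 = 1 := by simpa using h.a_sq
  have hb : b ^ 2 = 1 := by simpa using h.b_sq
  let χ : G →* Abelianization G := (powMonoidHom (2 ^ (l + 1))).comp Abelianization.of
  have hχ : χ = 1 := by
    refine h.hom_ext ?_ ?_ ?_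
    · change (Abelianization.of a) ^ _ = 1
      rw [pow_succ', pow_mul, ← map_pow, ha, map_one, one_pow]
    · change (Abelianization.of b) ^ _ = 1
      rw [pow_succ', pow_mul, ← map_pow, hb, map_one, one_pow]
    · change (Abelianization.of z) ^ _ = 1
      have := h.ab_pow
      rw [zero_add, zero_mul, zero_add] at this
      rw [← map_pow, ← this, map_pow, map_mul, mul_pow, pow_succ', pow_mul, pow_mul,
        ← map_pow _ a, ← map_pow _ b, ha, hb, map_one, one_pow, one_mul]
  exact DFunLike.congr_fun hχ g

/-- The power of b is z^(2^l). Were it in G', it would be ⁅x, a⁆ with x in the abelian subgroup,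
hence inverted by a since a² is central. Being central, it would have square 1, whereas z has order
2^(l+2). -/
theorem exists_abelianization_pow_ne_one [Finite G] (h : IsDihedralExt k (l + 1) e 1 a b z) :
    ∃ s : Abelianization G, s ^ 2 ^ (l + 1) ≠ 1 := by
  obtain ⟨s, ha, hb, hz⟩ := h.exists_sign
  have hB := h.comm_of_sign_eq_one ha hb hz
  have hB' : ∀ x ∈ s.ker, ∀ y ∈ s.ker, x * y = y * x := fun x hx y hy ↦
    congrArg Subtype.val (hB ⟨x, hx⟩ ⟨y, hy⟩)
  have hi : s.ker.index = 2 := by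
    have hs : Function.Surjective s := by
      intro u
      rcases Int.units_eq_one_or u with rfl | rfl
      · exact ⟨1, map_one s⟩
      · exact ⟨a, ha⟩
    rw [Subgroup.index_ker, MonoidHom.range_eq_top.2 hs, Subgroup.card_top,
      Nat.card_eq_fintype_card, Fintype.card_units_int]
  have haB : a ∉ s.ker := by rw [MonoidHom.mem_ker, ha]; decide
  have hzc : ∀ q : ℕ, z ^ q ∈ Subgroup.center G := fun q ↦
    pow_mem (h.center_eq ▸ Subgroup.mem_zpowers z) q
  refine ⟨Abelianization.of b, fun hb1 ↦ ?_⟩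
  have hbz : b ^ 2 ^ (l + 1) = z ^ 2 ^ l := by
    rw [pow_succ', pow_mul, h.b_sq, pow_one]
  rw [← map_pow, hbz, ← MonoidHom.mem_ker, Abelianization.ker_of] at hb1
  obtain ⟨x, hx⟩ := commutator_le_range_commutatorHom hB' hi haB hb1
  change (x : G) * (a * x * a⁻¹)⁻¹ = z ^ 2 ^ l at hx
  have h1 : a * z ^ 2 ^ l * a⁻¹ = (z ^ 2 ^ l)⁻¹ := by
    rw [← hx]
    have h2 : a ^ 2 * (x : G)⁻¹ = (x : G)⁻¹ * a ^ 2 := by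
      rw [h.a_sq]; exact (Subgroup.mem_center_iff.1 (hzc e) _).symm
    calc a * ((x : G) * (a * x * a⁻¹)⁻¹) * a⁻¹
      _ = (a * x * a⁻¹) * (a ^ 2 * (x : G)⁻¹) * (a ^ 2)⁻¹ := by
          rw [pow_two]; group
      _ = ((x : G) * (a * x * a⁻¹)⁻¹)⁻¹ := by rw [h2]; group
  rw [Subgroup.mem_center_iff.1 (hzc _) a, mul_inv_cancel_right, eq_inv_iff_mul_eq_one,
    ← pow_add, ← two_mul, ← pow_succ', ← orderOf_dvd_iff_pow_eq_one, h.orderOf_eq] at h1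
  exact absurd (Nat.le_of_dvd (by positivity) h1)
    (not_le.2 (Nat.pow_lt_pow_right (by norm_num) (Nat.lt_succ_self _)))

end IsDihedralExt

end Exponent

/-! ### Comparison of the types and the theorem -/

section Main

open MonoidAlgebra

/-- Changing generators, every group in the family has a presentation of one of four types. -/
theorem IsDihedralExt.exists_reduced {G : Type*} [Group G] {k l e f : ℕ} {a b z : G}
    (h : IsDihedralExt k l e f a b z)
    (hef : e = 0 ∧ f = 0 ∨ e = 0 ∧ f = 1 ∨ e = 1 ∧ f = 1) :
    ∃ (e f : ℕ) (a b z : G), IsDihedralExt k l e f a b z ∧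
      (e = 0 ∧ f = 0 ∨ e = 0 ∧ f = 1 ∧ (k ≠ 0 ∨ l ≠ 0) ∨ e = 1 ∧ f = 1 ∧ (k ≠ 0 ∨ l = 0)) := by
  rcases hef with ⟨rfl, rfl⟩ | ⟨rfl, rfl⟩ | ⟨rfl, rfl⟩
  · exact ⟨_, _, _, _, _, h, by simp⟩
  · by_cases hkl : k ≠ 0 ∨ l ≠ 0
    · exact ⟨_, _, _, _, _, h, by simp [hkl]⟩
    · push Not at hkl
      obtain ⟨rfl, rfl⟩ := hkl
      exact ⟨_, _, _, _, _, h.change_generators_order_eight, by simp⟩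
  · by_cases hkl : k ≠ 0 ∨ l = 0
    · exact ⟨_, _, _, _, _, h, by simp [hkl]⟩
    · push Not at hkl
      obtain ⟨rfl, hl⟩ := hkl
      obtain ⟨l, rfl⟩ := Nat.exists_eq_succ_of_ne_zero hl
      exact ⟨_, _, _, _, _, h.change_generators_of_class_two, by simp⟩

theorem IsDihedralExt.nonempty_mulEquiv {G H : Type*} [Group G] [Finite G] [Group H] [Finite H]
    {k l e f : ℕ} {a b z : G} {a' b' z' : H} (h : IsDihedralExt k l e f a b z)
    (h' : IsDihedralExt k l e f a' b' z') : Nonempty (G ≃* H) :=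
  h.toDihedralExtRel.nonempty_mulEquiv (by positivity) (by positivity) h.closure_eq_top h.card_eq
    h'.toDihedralExtRel h'.closure_eq_top h'.card_eq

theorem IsDihedralExt.not_algEquiv_of_zero_zero {F : Type*} [Field F] [CharP F 2]
    {G H : Type*} [Group G] [Finite G] [Group H] [Finite H] {k l e : ℕ} {a b z : G} {a' b' z' : H}
    (h : IsDihedralExt k l 0 0 a b z) (h' : IsDihedralExt k l e 1 a' b' z')
    (he : e = 0 ∧ (k ≠ 0 ∨ l ≠ 0) ∨ e = 1) (φ : MonoidAlgebra F G ≃ₐ[F] MonoidAlgebra F H) :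
    False := by
  cases l with
  | zero =>
    have hS := (h.squareZeroSeparates (F := F)).of_algEquiv φ
    rcases he with ⟨rfl, hk⟩ | rfl
    · obtain ⟨k, rfl⟩ := Nat.exists_eq_succ_of_ne_zero (hk.resolve_right (by simp))
      exact h'.not_squareZeroSeparates_of_sq_eq_one hS
    · exact h'.not_squareZeroSeparates hS
  | succ l =>
    obtain ⟨s, hs⟩ := h'.exists_abelianization_pow_ne_one
    exact hs (MonoidAlgebra.abelianization_pow_eq_one φ h.abelianization_pow_eq_one s)

theorem IsDihedralExt.not_algEquiv_of_zero_one {F : Type*} [Field F] [CharP F 2]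
    {G H : Type*} [Group G] [Finite G] [Group H] [Finite H] {k l : ℕ} {a b z : G} {a' b' z' : H}
    (h : IsDihedralExt k l 0 1 a b z) (h' : IsDihedralExt k l 1 1 a' b' z')
    (hk : k ≠ 0) (φ : MonoidAlgebra F G ≃ₐ[F] MonoidAlgebra F H) : False := by
  obtain ⟨k, rfl⟩ := Nat.exists_eq_succ_of_ne_zero hk
  exact h'.not_squareZeroDetects ((h.squareZeroDetects (F := F)).of_algEquiv φ.symm)

theorem theorem5p9
    {F : Type*} [Field F] [CharP F 2]
    {G : Type*} [Group G] [Finite G] (hG : IsPGroup 2 G)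
    {H : Type*} [Group H] [Finite H] (hH : IsPGroup 2 H)
    (hcyc : IsCyclic (Subgroup.center G))
    (hdih : IsDihedralTwoGroup (G ⧸ Subgroup.center G))
    (hiso : Nonempty (MonoidAlgebra F G ≃ₐ[F] MonoidAlgebra F H)) :
    Nonempty (G ≃* H) := by
  obtain ⟨φ⟩ := hiso
  obtain ⟨hne, a, b, ha, hb, hgen⟩ := hdih.exists_generators
  obtain ⟨k, l, e, f, a, b, z, h, hef⟩ := exists_isDihedralExt hG hne hcyc ha hb hgen
  have hcard := MonoidAlgebra.card_eq φ
  have hcardZ : Nat.card (Subgroup.center G) = Nat.card (Subgroup.center H) :=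
    le_antisymm (card_center_le hH φ) (card_center_le hG φ.symm)
  -- The orders of group and center agree on both sides, so H abelian would make G abelian.
  have hneH : ¬ ∀ x y : H, x * y = y * x := by
    intro hc
    refine hne fun x y ↦ ?_
    have hZ : Subgroup.center G = ⊤ := by
      rw [← Subgroup.card_eq_iff_eq_top, hcardZ, hcard, Subgroup.card_eq_iff_eq_top, eq_top_iff]
      exact fun x _ ↦ Subgroup.mem_center_iff.2 fun g ↦ hc g x
    exact Subgroup.mem_center_iff.1 (hZ ▸ Subgroup.mem_top y : y ∈ Subgroup.center G) x
  obtain ⟨a', b', ha', hb', hgen'⟩ := exists_generators_of_index_le_four hH hneH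
    ((MonoidAlgebra.index_commutator_sup_center_le hH φ).trans h.index_commutator_sup_center_le)
  obtain ⟨k', l', e', f', a', b', z', h', hef'⟩ := exists_isDihedralExt hH hneH
    (isCyclic_center hG hH φ hcyc) ha' hb' hgen'
  obtain rfl : l' = l := by
    rw [h.card_center, h'.card_center] at hcardZ
    have := Nat.pow_right_injective (le_refl 2) hcardZ
    omega
  obtain rfl : k' = k := by
    rw [h.card_eq, h'.card_eq] at hcard
    have h1 := Nat.eq_of_mul_eq_mul_right (by positivity) hcard
    have h2 := Nat.pow_right_injective (le_refl 2) (Nat.eq_of_mul_eq_mul_left (by norm_num) h1)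
    omega
  obtain ⟨e, f, a, b, z, h, hef⟩ := h.exists_reduced hef
  obtain ⟨e', f', a', b', z', h', hef'⟩ := h'.exists_reduced hef'
  rcases hef with ⟨rfl, rfl⟩ | ⟨rfl, rfl, hkl⟩ | ⟨rfl, rfl, hkl⟩ <;>
    rcases hef' with ⟨rfl, rfl⟩ | ⟨rfl, rfl, hkl'⟩ | ⟨rfl, rfl, hkl'⟩
  · exact h.nonempty_mulEquiv h'
  · exact (h.not_algEquiv_of_zero_zero h' (Or.inl ⟨rfl, hkl'⟩) φ).elim
  · exact (h.not_algEquiv_of_zero_zero h' (Or.inr rfl) φ).elim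
  · exact (h'.not_algEquiv_of_zero_zero h (Or.inl ⟨rfl, hkl⟩) φ.symm).elim
  · exact h.nonempty_mulEquiv h'
  -- The reduced conditions k ≠ 0 ∨ l ≠ 0 and k ≠ 0 ∨ l = 0 together force k ≠ 0.
  · exact (h.not_algEquiv_of_zero_one h' (by omega) φ).elim
  · exact (h'.not_algEquiv_of_zero_zero h (Or.inr rfl) φ.symm).elim
  · exact (h'.not_algEquiv_of_zero_one h (by omega) φ.symm).elim
  · exact h.nonempty_mulEquiv h'

end Main
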